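/- **Theorem.** Let $0<k<n-1$, $l=n-k$, and write $\mathbb C^n=\mathbb C^k\oplus\mathbb C^l$ with points $(x,y)$; all measures are Lebesgue measures, $\langle s,\xi\rangle=\sum_i s_i\xi_i$, and Fourier transforms are taken with respect to $e^{i\operatorname{Re}\langle s,\xi\rangle}$. Let $u(t)$ be an $l\times k$ matrix whose entries are polynomials in $t=(t_1,\dots,t_k)\in\mathbb C^k$, and let $$\omega(\xi,t)=\frac{\partial(\xi u(t))}{\partial t}\qquad(\xi\in\mathbb C^l)$$ be the (complex) Jacobian determinant of $t\mapsto\xi u(t)\in\mathbb C^k$. Assume that $u$ is nonsingular, i.e. that $\omega\not\equiv0$, and let $K$ be the complex of the $k$-planes $y=u(t)x+\alpha$, $(\alpha,t)\in\mathbb C^l\times\mathbb C^k$. Then the Crofton function $\mathrm{Cr}_K(\eta,\xi)=\#\{t\in\mathbb C^k:\eta=-\xi u(t)\}$ is almost everywhere on $\mathbb C^k\oplus\mathbb C^l$ equal to a constant, the Crofton number $\mathrm{Cr}_K$, with $0<\mathrm{Cr}_K<\infty$, and the following holds. For each $t\in\mathbb C^k$ let $a(\cdot,t)$ be a tempered generalized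 function on $\mathbb C^l$, such that for almost every $t$ its Fourier transform in $s$ is an ordinary (locally integrable) function $\tilde a(\cdot,t)$, and suppose that $\tilde a(\xi,t)\neq0$ for almost all $(\xi,t)$. For a Schwartz function $f$ on $\mathbb C^n$ put $$\varphi(\alpha,t)=(J_af)(\alpha,t)=\int f(x,y)\,a(y-u(t)x-\alpha,t)\,dx\,dy ,$$ i.e. $a(\cdot,t)$ applied to $s\mapsto\int f(x,u(t)x+\alpha+s)\,dx$. Then, for all $(x,y)\in\mathbb C^n$, $$f(x,y)=\int_{\mathbb C^k}\Bigl(\int_{\mathbb C^l}\varphi(\alpha,t)\,A(y-u(t)x-\alpha,t)\,d\alpha\Bigr)dt,\qquad A(s,t)=\frac1{(2\pi)^{2n}\,\mathrm{Cr}_K}\int_{\mathbb C^l}\tilde a(\xi,t)^{-1}\,|\omega(\xi,t)|^2\,e^{i\operatorname{Re}\langle s,\xi\rangle}\,d\xi .$$ Here $A(\cdot,t)$ is a generalized function given by its Fourier integral: for $A(s)=\int m(\xi)e^{i\operatorname{Re}\langle s,\xi\rangle}d\xi$ and a function $\psi$ that defines a tempered distribution whose Fourier transform is a locally integrable function $\tilde\psi$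 with $m\tilde\psi$ integrable, $\int A(s)\psi(s)\,ds$ means $\int m(\xi)\tilde\psi(\xi)\,d\xi$. It is part of the claim that for every $(x,y)$ the inner integral exists in this sense for almost every $t$ and that it is integrable in $t$. -/

import Mathlib

open MeasureTheory
open scoped SchwartzMap

namespace PlaneComplex

/-! ### Integrals of Schwartz functions over parallel planes are Schwartz functions -/

theorem hasFDerivAt_partialIntegral {E V F : Type} [NormedAddCommGroup E] [NormedSpace ℝ E]
    [NormedAddCommGroup V] [NormedSpace ℝ V] [NormedAddCommGroup F] [NormedSpace ℝ F]
    [MeasurableSpace E] [BorelSpace E] [SecondCountableTopology E]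
    (μ : Measure E) [μ.HasTemperateGrowth] (g : 𝓢(E × V, F)) :
    (∀ k : ℕ, ∃ C, ∀ b : V, ‖b‖ ^ k * ‖∫ x, g (x, b) ∂μ‖ ≤ C) ∧
    ∃ g' : 𝓢(E × V, V →L[ℝ] F),
      ∀ b : V, HasFDerivAt (fun b => ∫ x, g (x, b) ∂μ) (∫ x, g' (x, b) ∂μ) b := by
  obtain ⟨n, hn⟩ := ‹μ.HasTemperateGrowth›.exists_integrable
  have key : ∀ {G : Type} [NormedAddCommGroup G] [NormedSpace ℝ G] (h : 𝓢(E × V, G)) (k : ℕ),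
      ∃ C, ∀ (x : E) (b : V), ‖b‖ ^ k * ‖h (x, b)‖ ≤ (1 + ‖x‖) ^ (-(n : ℝ)) * C := by
    intro G _ _ h k
    refine ⟨2 ^ (n + k) * ((Finset.Iic (n + k, 0)).sup
      fun m => SchwartzMap.seminorm ℝ m.1 m.2) h, fun x b => ?_⟩
    rw [Real.rpow_neg (by positivity), ← div_eq_inv_mul, le_div_iff₀' (by positivity),
      Real.rpow_natCast]
    have h1 := SchwartzMap.one_add_le_sup_seminorm_apply (𝕜 := ℝ) (m := (n + k, 0)) (k := n + k)
      (n := 0) le_rfl le_rfl h (x, b)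
    rw [norm_iteratedFDeriv_zero] at h1
    refine le_trans ?_ h1
    rw [← mul_assoc, pow_add]
    have hx : ‖x‖ ≤ ‖(x, b)‖ := norm_fst_le (x, b)
    have hb : ‖b‖ ≤ 1 + ‖(x, b)‖ := (norm_snd_le (x, b)).trans (by linarith)
    gcongr
  have meas : ∀ {G : Type} [NormedAddCommGroup G] [NormedSpace ℝ G] (h : 𝓢(E × V, G)) (b : V),
      AEStronglyMeasurable (fun x => h (x, b)) μ := fun h b =>
    (h.continuous.comp (by fun_prop : Continuous fun x : E => (x, b))).aestronglyMeasurable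
  have integ : ∀ {G : Type} [NormedAddCommGroup G] [NormedSpace ℝ G] (h : 𝓢(E × V, G)) (b : V),
      Integrable (fun x => h (x, b)) μ := by
    intro G _ _ h b
    obtain ⟨C, hC⟩ := key h 0
    exact (hn.mul_const C).mono' (meas h b) (.of_forall fun x => by simpa using hC x b)
  refine ⟨fun k => ?_, ?_⟩
  · obtain ⟨C, hC⟩ := key g k
    refine ⟨∫ x, (1 + ‖x‖) ^ (-(n : ℝ)) * C ∂μ, fun b => ?_⟩
    calc ‖b‖ ^ k * ‖∫ x, g (x, b) ∂μ‖ ≤ ‖b‖ ^ k * ∫ x, ‖g (x, b)‖ ∂μ := by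
          gcongr; exact norm_integral_le_integral_norm _
      _ = ∫ x, ‖b‖ ^ k * ‖g (x, b)‖ ∂μ := (integral_const_mul _ _).symm
      _ ≤ _ := integral_mono ((integ g b).norm.const_mul _) (hn.mul_const C) fun x => hC x b
  · let R : ((E × V) →L[ℝ] F) →L[ℝ] (V →L[ℝ] F) :=
      (ContinuousLinearMap.compL ℝ V (E × V) F).flip (ContinuousLinearMap.inr ℝ E V)
    let g' : 𝓢(E × V, V →L[ℝ] F) := (SchwartzMap.fderivCLM ℝ (E × V) F g).postcompCLM R
    refine ⟨g', fun b => ?_⟩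
    obtain ⟨C, hC⟩ := key g' 0
    refine hasFDerivAt_integral_of_dominated_of_fderiv_le (s := Set.univ)
      (F' := fun b x => g' (x, b))
      (bound := fun x => (1 + ‖x‖) ^ (-(n : ℝ)) * C) Filter.univ_mem
      (.of_forall fun b => meas g b) (integ g b) (meas g' b)
      (.of_forall fun x b _ => by simpa using hC x b) (hn.mul_const C)
      (.of_forall fun x b _ => ?_)
    have h1 := (g.differentiableAt (x := (x, b))).hasFDerivAt
    have h2 : HasFDerivAt (fun b : V => (x, b)) (ContinuousLinearMap.inr ℝ E V) b :=
      (hasFDerivAt_const x b).prodMk (hasFDerivAt_id b)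
    exact h1.comp b h2

theorem contDiff_decay_partialIntegral {E V : Type} [NormedAddCommGroup E] [NormedSpace ℝ E]
    [NormedAddCommGroup V] [NormedSpace ℝ V]
    [MeasurableSpace E] [BorelSpace E] [SecondCountableTopology E]
    (μ : Measure E) [μ.HasTemperateGrowth] (n : ℕ) :
    ∀ {F : Type} [NormedAddCommGroup F] [NormedSpace ℝ F] (g : 𝓢(E × V, F)),
    ContDiff ℝ n (fun b => ∫ x, g (x, b) ∂μ) ∧
    ∀ k : ℕ, ∃ C, ∀ b : V,
      ‖b‖ ^ k * ‖iteratedFDeriv ℝ n (fun b => ∫ x, g (x, b) ∂μ) b‖ ≤ C := by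
  induction n with
  | zero =>
    intro F _ _ g
    obtain ⟨h1, g', h2⟩ := hasFDerivAt_partialIntegral μ g
    refine ⟨?_, by simpa using h1⟩
    simpa using continuous_iff_continuousAt.2 fun b => (h2 b).continuousAt
  | succ n ih =>
    intro F _ _ g
    obtain ⟨-, g', h2⟩ := hasFDerivAt_partialIntegral μ g
    have h3 : fderiv ℝ (fun b => ∫ x, g (x, b) ∂μ) = fun b => ∫ x, g' (x, b) ∂μ :=
      funext fun b => (h2 b).fderiv
    obtain ⟨h4, h5⟩ := ih g'
    refine ⟨?_, ?_⟩
    · push_cast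
      rw [contDiff_succ_iff_fderiv]
      exact ⟨fun b => (h2 b).differentiableAt, by simp, by rw [h3]; exact h4⟩
    · intro k
      obtain ⟨C, hC⟩ := h5 k
      refine ⟨C, fun b => ?_⟩
      rw [← norm_iteratedFDeriv_fderiv, h3]
      exact hC b

/-- The Schwartz function `s ↦ ∫ f(x, M x + α + s) dx` on `ℂ^l`: the integrals of `f` over the
planes `y = M x + (α + s)`, as a function of the shift `s`. -/
noncomputable def planeIntegral {k l : ℕ} (f : 𝓢((Fin k → ℂ) × (Fin l → ℂ), ℂ))
    (M : Matrix (Fin l) (Fin k) ℂ) (α : Fin l → ℂ) : 𝓢(Fin l → ℂ, ℂ) :=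
  have key : ∃ g : 𝓢((Fin k → ℂ) × (Fin l → ℂ), ℂ),
      ∀ x s, g (x, s) = f (x, M.mulVec x + α + s) := by
    let L : (Fin k → ℂ) →L[ℝ] (Fin l → ℂ) :=
      (LinearMap.toContinuousLinearMap (M.mulVecLin)).restrictScalars ℝ
    let e : ((Fin k → ℂ) × (Fin l → ℂ)) ≃L[ℝ] ((Fin k → ℂ) × (Fin l → ℂ)) :=
      ContinuousLinearEquiv.equivOfInverse
        ((ContinuousLinearMap.fst ℝ _ _).prod
          (L.comp (ContinuousLinearMap.fst ℝ _ _) + ContinuousLinearMap.snd ℝ _ _))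
        ((ContinuousLinearMap.fst ℝ _ _).prod
          (ContinuousLinearMap.snd ℝ _ _ - L.comp (ContinuousLinearMap.fst ℝ _ _)))
        (fun p => by simp) (fun p => by simp)
    refine ⟨SchwartzMap.compCLMOfContinuousLinearEquiv ℝ e
      (SchwartzMap.compSubConstCLM ℝ (0, -α) f), fun x s => ?_⟩
    simp only [SchwartzMap.compCLMOfContinuousLinearEquiv_apply, Function.comp,
      SchwartzMap.compSubConstCLM_apply]
    congr 1
    ext i <;> simp [e, L]
    ring
  { toFun := fun s => ∫ x, f (x, M.mulVec x + α + s)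
    smooth' := by
      obtain ⟨g, hg⟩ := key
      simp only [← hg]
      exact contDiff_infty.2 fun n => (contDiff_decay_partialIntegral volume n g).1
    decay' := by
      obtain ⟨g, hg⟩ := key
      simp only [← hg]
      exact fun m n => (contDiff_decay_partialIntegral volume n g).2 m }

/-! ### Fourier transform on `ℂ^l` with respect to `exp (i Re ⟨s, ξ⟩)`, `⟨s, ξ⟩ = ∑ sᵢ ξᵢ` -/

theorem exists_schwartz_fourier {l : ℕ} (χ : 𝓢(Fin l → ℂ, ℂ)) : ∃ g : 𝓢(Fin l → ℂ, ℂ), ∀ s,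
    g s = ∫ ξ, χ ξ * Complex.exp (Complex.I * ((s ⬝ᵥ ξ).re : ℂ)) := by
  let E := EuclideanSpace ℂ (Fin l)
  let e : E ≃L[ℝ] (Fin l → ℂ) := PiLp.continuousLinearEquiv 2 ℝ (fun _ : Fin l => ℂ)
  let cj : (Fin l → ℂ) ≃L[ℝ] (Fin l → ℂ) :=
    ContinuousLinearEquiv.piCongrRight fun _ => Complex.conjCLE
  let sc : (Fin l → ℂ) ≃L[ℝ] (Fin l → ℂ) :=
    ContinuousLinearEquiv.smulLeft (Units.mk0 (-(2 * Real.pi)⁻¹ : ℝ)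
      (by simp [Real.pi_ne_zero]))
  let χ' : 𝓢(E, ℂ) := SchwartzMap.compCLMOfContinuousLinearEquiv ℝ e χ
  let d : (Fin l → ℂ) ≃L[ℝ] E := (cj.trans sc).trans e.symm
  let ψ : 𝓢(Fin l → ℂ, ℂ) := SchwartzMap.compCLMOfContinuousLinearEquiv ℝ d (FourierTransform.fourier χ')
  let ν : Measure (Fin l → ℂ) := Measure.map e volume
  have : ν.IsAddHaarMeasure := e.isAddHaarMeasure_map volume
  obtain ⟨c, hc⟩ : ∃ c : NNReal, (volume : Measure (Fin l → ℂ)) = c • ν :=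
    ⟨_, Measure.isAddLeftInvariant_eq_smul volume ν⟩
  refine ⟨(c : ℝ) • ψ, fun s => ?_⟩
  rw [hc, integral_smul_nnreal_measure]
  simp only [smul_apply]
  congr 1
  simp only [ψ, SchwartzMap.compCLMOfContinuousLinearEquiv_apply, Function.comp,
    SchwartzMap.fourier_coe, Real.fourier_eq']
  have hν : ν = Measure.map e.toHomeomorph.toMeasurableEquiv volume := rfl
  rw [hν, integral_map_equiv e.toHomeomorph.toMeasurableEquiv]
  refine integral_congr_ae (.of_forall fun v => ?_)
  change _ • χ (e v) = χ (e v) * _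
  rw [smul_eq_mul, mul_comm]
  congr 2
  rw [mul_comm Complex.I]
  congr 2
  have h1 : inner ℝ v (d s) = -(2 * Real.pi)⁻¹ * (s ⬝ᵥ e v).re := by
    have h3 : ∀ i, (d s) i = -(2 * Real.pi : ℂ)⁻¹ * (starRingEnd ℂ) (s i) := fun i => by
      change (-(2 * Real.pi)⁻¹ : ℝ) • (starRingEnd ℂ) (s i) = _
      rw [Complex.real_smul]; push_cast; ring
    have h4 : ∀ i, (e v) i = v i := fun i => rfl
    rw [PiLp.inner_apply]
    simp only [dotProduct, Complex.re_sum, Finset.mul_sum, h3, h4, Complex.inner]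
    refine Finset.sum_congr rfl fun i _ => ?_
    rw [mul_assoc, ← map_mul, ← Complex.conj_re (s i * v i)]
    have : (-(2 * Real.pi : ℂ)⁻¹) = ((-(2 * Real.pi)⁻¹ : ℝ) : ℂ) := by push_cast; ring
    rw [this, Complex.re_ofReal_mul]
  rw [h1]
  field_simp
  rfl

/-- The Fourier transform `s ↦ ∫ χ(ξ) exp (i Re ⟨s, ξ⟩) dξ` of a Schwartz function on `ℂ^l`. -/
noncomputable def fourierSchwartz {l : ℕ} (χ : 𝓢(Fin l → ℂ, ℂ)) : 𝓢(Fin l → ℂ, ℂ) where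
  toFun s := ∫ ξ, χ ξ * Complex.exp (Complex.I * ((s ⬝ᵥ ξ).re : ℂ))
  smooth' := by
    obtain ⟨g, hg⟩ := exists_schwartz_fourier χ
    simp only [← hg]
    exact g.smooth'
  decay' := by
    obtain ⟨g, hg⟩ := exists_schwartz_fourier χ
    simp only [← hg]
    exact g.decay'

/-- The Fourier transform of the generalized function `T` on `ℂ^l` is the ordinary (locally
integrable) function `g`. By duality this means `⟨T, χ̃⟩ = ∫ g χ` for all test functions `χ`,
that is, for all smooth compactly supported `χ`. -/
def HasFourierFunction {l : ℕ} (T : 𝓢(Fin l → ℂ, ℂ) → ℂ) (g : (Fin l → ℂ) → ℂ) : Prop :=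
  LocallyIntegrable g ∧ ∀ χ : 𝓢(Fin l → ℂ, ℂ), HasCompactSupport χ →
    T (fourierSchwartz χ) = ∫ ξ, g ξ * χ ξ

/-- `v` is the value `∫ B(s) ψ(s) ds` of the generalized function
`B(s) = ∫ m(ξ) exp (i Re ⟨s, ξ⟩) dξ` on the function `ψ`. As always for a generalized function given
by a Fourier integral, the value is defined by Parseval's equality: it is `∫ m(ξ) ψ̃(ξ) dξ`, where
`ψ̃` is the Fourier transform of `ψ`. Here `ψ` may be any function that defines a tempered
distribution whose Fourier transform is an ordinary function, and `m ψ̃` has to be integrable. -/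
def HasFourierPairing {l : ℕ} (m ψ : (Fin l → ℂ) → ℂ) (v : ℂ) : Prop :=
  (∀ χ : 𝓢(Fin l → ℂ, ℂ), Integrable fun s => ψ s * χ s) ∧
  ∃ g : (Fin l → ℂ) → ℂ, HasFourierFunction (fun χ => ∫ s, ψ s * χ s) g ∧
    Integrable (fun ξ => m ξ * g ξ) ∧ v = ∫ ξ, m ξ * g ξ

/-- The value in `HasFourierPairing` is unique. -/
theorem HasFourierPairing.unique {l : ℕ} {m ψ : (Fin l → ℂ) → ℂ} {v w : ℂ}
    (hv : HasFourierPairing m ψ v) (hw : HasFourierPairing m ψ w) : v = w := by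
  obtain ⟨-, g, ⟨hg, hg'⟩, -, rfl⟩ := hv
  obtain ⟨-, h, ⟨hh, hh'⟩, -, rfl⟩ := hw
  have key : g =ᵐ[volume] h := by
    refine ae_eq_of_integral_contDiff_smul_eq hg hh fun b hb hbc => ?_
    have hb' : ContDiff ℝ (⊤ : ℕ∞) fun ξ => (b ξ : ℂ) := Complex.ofRealCLM.contDiff.comp hb
    have hbc' : HasCompactSupport fun ξ => (b ξ : ℂ) :=
      hbc.comp_left (g := fun r : ℝ => (r : ℂ)) rfl
    have h1 := (hg' (hbc'.toSchwartzMap hb') hbc').symm.trans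
      (hh' (hbc'.toSchwartzMap hb') hbc')
    simpa [Complex.real_smul, mul_comm] using h1
  refine integral_congr_ae ?_
  filter_upwards [key] with ξ hξ
  rw [hξ]

/-- For integrable `m` and `ψ` the pairing is the literal double integral. -/
theorem hasFourierPairing_of_integrable {l : ℕ} {m ψ : (Fin l → ℂ) → ℂ}
    (hm : Integrable m) (hψ : Integrable ψ) :
    HasFourierPairing m ψ
      (∫ s, (∫ ξ, m ξ * Complex.exp (Complex.I * ((s ⬝ᵥ ξ).re : ℂ))) * ψ s) := by
  have hE : Continuous fun p : (Fin l → ℂ) × (Fin l → ℂ) =>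
      Complex.exp (Complex.I * ((p.1 ⬝ᵥ p.2).re : ℂ)) := by
    unfold dotProduct
    fun_prop
  have hE1 : ∀ s ξ : Fin l → ℂ, ‖Complex.exp (Complex.I * ((s ⬝ᵥ ξ).re : ℂ))‖ = 1 := fun s ξ => by
    rw [mul_comm]; exact Complex.norm_exp_ofReal_mul_I _
  have swap : ∀ {h : (Fin l → ℂ) → ℂ}, Integrable h →
      ∫ s, ψ s * ∫ ξ, h ξ * Complex.exp (Complex.I * ((s ⬝ᵥ ξ).re : ℂ)) =
        ∫ ξ, (∫ s, ψ s * Complex.exp (Complex.I * ((s ⬝ᵥ ξ).re : ℂ))) * h ξ := by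
    intro h hh
    have hi : Integrable (fun p : (Fin l → ℂ) × (Fin l → ℂ) =>
        ψ p.1 * h p.2 * Complex.exp (Complex.I * ((p.1 ⬝ᵥ p.2).re : ℂ)))
        (volume.prod volume) :=
      (hψ.mul_prod hh).mul_bdd (c := 1) hE.aestronglyMeasurable
        (.of_forall fun p => (hE1 p.1 p.2).le)
    have h1 := integral_integral_swap (f := fun s ξ =>
      ψ s * h ξ * Complex.exp (Complex.I * ((s ⬝ᵥ ξ).re : ℂ))) hi
    simp only [← integral_const_mul, ← integral_mul_const]
    calc _ = _ := by simp only [mul_assoc]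
      _ = _ := h1
      _ = _ := by simp only [mul_right_comm]
  have hgc : Continuous fun ξ : Fin l → ℂ =>
      ∫ s, ψ s * Complex.exp (Complex.I * ((s ⬝ᵥ ξ).re : ℂ)) := by
    refine continuous_of_dominated (bound := fun s => ‖ψ s‖) (fun ξ => ?_) (fun ξ => ?_)
      hψ.norm ?_
    · exact hψ.aestronglyMeasurable.mul
        (hE.comp (by fun_prop : Continuous fun s => (s, ξ))).aestronglyMeasurable
    · exact .of_forall fun s => by rw [norm_mul, hE1, mul_one]
    · exact .of_forall fun s => continuous_const.mul
        (hE.comp (by fun_prop : Continuous fun ξ => (s, ξ)))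
  refine ⟨fun χ => ?_, _, ⟨hgc.locallyIntegrable, fun χ _ => swap χ.integrable⟩, ?_, ?_⟩
  · obtain ⟨C, -, hC⟩ := χ.decay 0 0
    exact hψ.mul_bdd (c := C) χ.continuous.aestronglyMeasurable
      (.of_forall fun s => by simpa using hC s)
  · refine hm.mul_bdd (c := ∫ s, ‖ψ s‖) hgc.aestronglyMeasurable (.of_forall fun ξ => ?_)
    refine (norm_integral_le_integral_norm _).trans_eq ?_
    simp only [norm_mul, hE1, mul_one]
  · simp only [mul_comm (m _) (∫ _, _)]
    rw [← swap hm]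
    simp only [mul_comm (ψ _)]

/-! ### The complex of planes `y = u(t) x + α` -/

/-- The matrix `u(t)`. -/
noncomputable def evalMatrix {k l : ℕ} (u : Matrix (Fin l) (Fin k) (MvPolynomial (Fin k) ℂ))
    (t : Fin k → ℂ) : Matrix (Fin l) (Fin k) ℂ :=
  u.map (MvPolynomial.eval t)

/-- The complex Jacobian `ω(ξ, t) = ∂(ξ u(t)) / ∂t` of the map `t ↦ ξ u(t)` of `ℂ^k` to itself. -/
noncomputable def jacobian {k l : ℕ} (u : Matrix (Fin l) (Fin k) (MvPolynomial (Fin k) ℂ))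
    (ξ : Fin l → ℂ) (t : Fin k → ℂ) : ℂ :=
  Matrix.det (Matrix.of fun j m : Fin k =>
    ∑ i, ξ i * MvPolynomial.eval t (MvPolynomial.pderiv m (u i j)))

/-- `u` is nonsingular: the maps `t ↦ ξ u(t)` are not all degenerate, i.e. the Jacobian `ω` is not
identically zero. -/
def IsNonsingular {k l : ℕ} (u : Matrix (Fin l) (Fin k) (MvPolynomial (Fin k) ℂ)) : Prop :=
  ∃ ξ t, jacobian u ξ t ≠ 0

/-- The Crofton function: the number of solutions `t` of `η = -ξ u(t)`. -/
noncomputable def croftonFunction {k l : ℕ}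
    (u : Matrix (Fin l) (Fin k) (MvPolynomial (Fin k) ℂ)) (η : Fin k → ℂ) (ξ : Fin l → ℂ) : ℕ∞ :=
  Set.encard {t : Fin k → ℂ | η = -(Matrix.vecMul ξ (evalMatrix u t))}

/-- `N` is the Crofton number: the Crofton function is equal to `N` almost everywhere. -/
def IsCroftonNumber {k l : ℕ} (u : Matrix (Fin l) (Fin k) (MvPolynomial (Fin k) ℂ)) (N : ℕ) :
    Prop :=
  ∀ᵐ p : (Fin k → ℂ) × (Fin l → ℂ), croftonFunction u p.1 p.2 = N

/-- The generalized transform `(J_a f)(α, t) = ∫ f(x, y) a(y - u(t) x - α, t) dx dy`, i.e. the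
generalized function `a(·, t)` applied to `s ↦ ∫ f(x, u(t) x + α + s) dx`. -/
noncomputable def transform {k l : ℕ} (u : Matrix (Fin l) (Fin k) (MvPolynomial (Fin k) ℂ))
    (a : (Fin k → ℂ) → 𝓢'(Fin l → ℂ, ℂ)) (f : 𝓢((Fin k → ℂ) × (Fin l → ℂ), ℂ))
    (α : Fin l → ℂ) (t : Fin k → ℂ) : ℂ :=
  a t (planeIntegral f (evalMatrix u t) α)

/-- The density of the inversion kernel: the kernel is the generalized function
`A(s, t) = ∫ kernelDensity u N ã t ξ * exp (i Re ⟨s, ξ⟩) dξ`, where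
`kernelDensity u N ã t ξ = (2π)^{-2n} N⁻¹ ã(ξ, t)⁻¹ |ω(ξ, t)|²` with `n = k + l`. -/
noncomputable def kernelDensity {k l : ℕ} (u : Matrix (Fin l) (Fin k) (MvPolynomial (Fin k) ℂ))
    (N : ℕ) (ã : (Fin l → ℂ) → (Fin k → ℂ) → ℂ) (t : Fin k → ℂ) (ξ : Fin l → ℂ) : ℂ :=
  ((2 * Real.pi : ℝ) ^ (2 * (k + l)) : ℂ)⁻¹ * (N : ℂ)⁻¹ * (ã ξ t)⁻¹ *
    (‖jacobian u ξ t‖ ^ 2 : ℝ)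

end PlaneComplex

namespace PlaneComplex

/-! ### Generic fibres of a polynomial map with algebraically independent components -/

/-! The formula is Fourier inversion of `f` on `ℂ^k ⊕ ℂ^l`, read in the coordinates `(t, ξ)` with `η
= -ξ u(t)`.

Fix `t` and put `M = u(t)`, `c = y - M x`. By a shear and Fubini, the Fourier transform at `-ξ` of
the plane integrals of `f` is `F(-ξ M, ξ)`, where `F(η, ξ) = ∫ f(x, y) exp(-i Re(⟨x, η⟩ + ⟨y, ξ⟩))
dx dy` (`integral_planeIntegral_mul_planeWave`). The function `s ↦ φ(c - s, t)` is a convolution of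
`a(·, t)` with these integrals, so its Fourier transform is the product of `ã(ξ, t)`, the phase
`exp(i Re⟨c, ξ⟩)` and `F(-ξ M, ξ)` (`hasFourierFunction_convolution`). In the pairing with `A(·, t)`
the factor `ã` cancels. What remains, apart from the constant `((2π)^{2n} Cr_K)⁻¹`, is `|ω|²` times
the Fourier inversion integrand of `f` at `(x, y)`, evaluated at `(-ξ u(t), ξ)`.

The map `(t, ξ) ↦ (-ξ u(t), ξ)` has real Jacobian `|ω|²` and fibres counted by the Crofton function.
If that count is almost everywhere `N`, the area formula (`map_withDensity_abs_det`) turns the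
integral over `(t, ξ)` into `N` times the inversion integral, that is, `N (2π)^{2n} f(x, y)`; the
two constants cancel.

The count is constant for an algebraic reason. A polynomial map with nonvanishing Jacobian has
algebraically independent components and is defined over a countable field `F`. Almost every point
has coordinates algebraically independent over `F`, and the fibre over such a point is in bijection
with the embeddings into `ℂ` of a function field over the subfield generated by the components.
Their number is the finite, positive degree of the extension
(`exists_encard_generic_fibre_of_isFractionRing`). -/

theorem isTranscendenceBasis_mvPolynomial {σ F : Type} [Finite σ] [Field F]
    {p : σ → MvPolynomial σ F} (hp : AlgebraicIndependent F p) : IsTranscendenceBasis F p :=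
  hp.isTranscendenceBasis_of_trdeg_le_of_finite (by
    rw [MvPolynomial.trdeg_of_isDomain, Cardinal.lift_id])

/-- A point with generic image is generic. -/
theorem algebraicIndependent_of_aeval {σ F Ω : Type} [Finite σ] [Field F] [Field Ω] [Algebra F Ω]
    {p : σ → MvPolynomial σ F} (hp : AlgebraicIndependent F p) {z : σ → Ω}
    (hz : AlgebraicIndependent F fun j => MvPolynomial.aeval z (p j)) :
    AlgebraicIndependent F z := by
  have := (isTranscendenceBasis_mvPolynomial hp).isAlgebraic
  rw [algebraicIndependent_iff]
  intro h hh
  by_contra h0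
  -- A nonzero `h` vanishing at `z` is algebraic over `F[p]`, so the ideal of polynomials vanishing
  -- at `z` would contain a nonzero element of `F[p]`. That element is a relation between the values
  -- `p j (z)`, which are independent.
  refine Ideal.comap_ne_bot_of_algebraic_mem (R := Algebra.adjoin F (Set.range p))
    (I := RingHom.ker (MvPolynomial.aeval (R := F) z).toRingHom) h0 hh
    (Algebra.IsAlgebraic.isAlgebraic h) ?_
  rw [eq_bot_iff]
  rintro ⟨b, hb⟩ hbz
  obtain ⟨c, rfl⟩ : ∃ c, MvPolynomial.aeval p c = b := by
    rw [Algebra.adjoin_range_eq_range_aeval] at hb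
    exact hb
  have h1 : MvPolynomial.aeval (fun j => MvPolynomial.aeval z (p j)) c = 0 := by
    have h2 : MvPolynomial.aeval z (MvPolynomial.aeval p c) = 0 := hbz
    rwa [← MvPolynomial.comp_aeval_apply]
  have h2 := (algebraicIndependent_iff.1 hz) c h1
  refine Subtype.ext ?_
  change MvPolynomial.aeval p c = 0
  rw [h2, map_zero]

/-- The number of points in a generic fibre of a polynomial map is independent of the fibre: it is
the degree of the corresponding extension of function fields. -/
theorem exists_encard_generic_fibre_of_isFractionRing {σ F Ω L : Type} [Finite σ] [Field F]
    [CharZero F]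
    [Field Ω] [IsAlgClosed Ω] [Algebra F Ω] [Field L] [Algebra (MvPolynomial σ F) L]
    [IsFractionRing (MvPolynomial σ F) L] [Algebra F L] [IsScalarTower F (MvPolynomial σ F) L]
    {p : σ → MvPolynomial σ F} (hp : AlgebraicIndependent F p) :
    ∃ N : ℕ, N ≠ 0 ∧ ∀ q : σ → Ω, AlgebraicIndependent F q →
      Set.encard {z : σ → Ω | ∀ j, MvPolynomial.aeval z (p j) = q j} = N := by
  let ι : MvPolynomial σ F →ₐ[F] L := IsScalarTower.toAlgHom F (MvPolynomial σ F) L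
  have hι : Function.Injective ι := IsFractionRing.injective (MvPolynomial σ F) L
  let P : σ → L := fun j => ι (p j)
  have hP : AlgebraicIndependent F P := hp.map' hι
  have hPt : IsTranscendenceBasis F P := by
    have : Algebra.IsAlgebraic (MvPolynomial σ F) L :=
      (IsFractionRing.comap_isAlgebraic_iff (K := L)).2 inferInstance
    exact (isTranscendenceBasis_mvPolynomial hp).algebraMap_comp
  let K := IntermediateField.adjoin F (Set.range P)
  have : Algebra.IsAlgebraic K L := hPt.isAlgebraic_field
  have : Algebra.EssFiniteType F L := by
    have : Algebra.EssFiniteType (MvPolynomial σ F) L :=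
      Algebra.EssFiniteType.of_isLocalization L (nonZeroDivisors (MvPolynomial σ F))
    exact Algebra.EssFiniteType.comp F (MvPolynomial σ F) L
  have : Algebra.EssFiniteType K L := Algebra.EssFiniteType.of_comp F K L
  have : Module.Finite K L := Algebra.finite_of_essFiniteType_of_isAlgebraic
  refine ⟨Module.finrank K L, Module.finrank_pos.ne', fun q hq => ?_⟩
  -- Both `F(P)` and `F(q)` are rational function fields on the same index set, so `P i ↦ q i`
  -- extends to an embedding of `K`. It makes `Ω` an extension of `K`.
  let j : K →ₐ[F] Ω := ((IntermediateField.adjoin F (Set.range q)).val.comp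
    hq.aevalEquivField.toAlgHom).comp hP.aevalEquivField.symm.toAlgHom
  have hj : ∀ (i : σ) (h : P i ∈ K), j ⟨P i, h⟩ = q i := by
    intro i h
    have h1 : hP.aevalEquivField.symm ⟨P i, h⟩ =
        algebraMap (MvPolynomial σ F) (FractionRing (MvPolynomial σ F)) (MvPolynomial.X i) := by
      rw [AlgEquiv.symm_apply_eq]
      exact Subtype.ext ((hP.aevalEquivField_algebraMap_apply_coe _).trans
        (MvPolynomial.aeval_X _ _)).symm
    change (hq.aevalEquivField (hP.aevalEquivField.symm ⟨P i, h⟩) : Ω) = q i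
    rw [h1]
    simp
  let : Algebra K Ω := j.toRingHom.toAlgebra
  have hKΩ : ∀ c : K, algebraMap K Ω c = j c := fun c => rfl
  have : IsScalarTower F K Ω := .of_algebraMap_eq fun c => (j.commutes c).symm
  -- In characteristic zero the extension is separable, and `Ω` is algebraically closed, so there
  -- are as many embeddings as the degree.
  have hcard : Nat.card (L →ₐ[K] Ω) = Module.finrank K L := by
    rw [← AlgHom.card K L Ω, Nat.card_eq_fintype_card]
  have hval : ∀ (h : L →ₐ[F] Ω) (a : MvPolynomial σ F),
      MvPolynomial.aeval (fun i => h (ι (MvPolynomial.X i))) a = h (ι a) := by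
    intro h a
    change _ = (h.comp ι) a
    congr 1
    apply MvPolynomial.algHom_ext
    simp
  have hmem : ∀ i, P i ∈ K := fun i => IntermediateField.subset_adjoin _ _ ⟨i, rfl⟩
  -- An embedding is recorded by the images of the coordinates; fixing `K` means exactly that this
  -- point lies over `q`.
  let e : (L →ₐ[K] Ω) → {z : σ → Ω | ∀ j, MvPolynomial.aeval z (p j) = q j} := fun h =>
    ⟨fun i => h (ι (MvPolynomial.X i)), fun i => by
      refine (hval (h.restrictScalars F) (p i)).trans ?_
      change h (P i) = q i
      rw [← hj i (hmem i), ← hKΩ, ← h.commutes]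
      rfl⟩
  have he : Function.Bijective e := by
    refine ⟨fun h₁ h₂ h => ?_, fun z => ?_⟩
    · have h3 : (h₁.restrictScalars F) = h₂.restrictScalars F := by
        apply AlgHom.coe_ringHom_injective
        apply IsLocalization.ringHom_ext (nonZeroDivisors (MvPolynomial σ F))
        apply RingHom.ext
        intro a
        have h4 := hval (h₁.restrictScalars F) a
        have h5 := hval (h₂.restrictScalars F) a
        have h6 : (fun i => h₁ (ι (MvPolynomial.X i))) = fun i => h₂ (ι (MvPolynomial.X i)) :=
          congrArg Subtype.val h
        change (h₁.restrictScalars F) (ι a) = (h₂.restrictScalars F) (ι a)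
        rw [← h4, ← h5]
        exact congrArg (fun w => MvPolynomial.aeval w a) h6
      exact AlgHom.ext fun x => DFunLike.congr_fun h3 x
    · obtain ⟨z, hz⟩ := z
      -- Every point of a generic fibre is itself generic, so evaluation at it is injective on
      -- polynomials and extends to the fraction field.
      have hz' : AlgebraicIndependent F z :=
        algebraicIndependent_of_aeval hp (by
          rw [show (fun j => MvPolynomial.aeval z (p j)) = q from funext hz]; exact hq)
      let h : L →ₐ[F] Ω := IsFractionRing.liftAlgHom (g := MvPolynomial.aeval z) hz'
      have hh : ∀ a : MvPolynomial σ F, h (ι a) = MvPolynomial.aeval z a := fun a =>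
        IsFractionRing.lift_algebraMap (K := L) hz' a
      have hc : h.comp K.val = j := by
        apply IntermediateField.adjoin_algHom_ext
        rintro _ ⟨i, rfl⟩
        rw [hj]
        exact (hh (p i)).trans (hz i)
      refine ⟨{ h with commutes' := fun c => DFunLike.congr_fun hc c }, ?_⟩
      ext i
      exact (hh _).trans (by simp)
  rw [← hcard, Nat.card_congr (Equiv.ofBijective e he), Nat.card_coe_set_eq]
  have : Finite {z : σ → Ω | ∀ j, MvPolynomial.aeval z (p j) = q j} :=
    Finite.of_surjective e he.2
  exact (Set.Finite.cast_ncard_eq (Set.toFinite _)).symm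

theorem exists_encard_generic_fibre {σ F : Type} (Ω : Type) [Finite σ] [Field F] [CharZero F]
    [Field Ω] [IsAlgClosed Ω] [Algebra F Ω]
    {p : σ → MvPolynomial σ F} (hp : AlgebraicIndependent F p) :
    ∃ N : ℕ, N ≠ 0 ∧ ∀ q : σ → Ω, AlgebraicIndependent F q →
      Set.encard {z : σ → Ω | ∀ j, MvPolynomial.aeval z (p j) = q j} = N :=
  exists_encard_generic_fibre_of_isFractionRing (L := FractionRing (MvPolynomial σ F)) hp

/-! ### Polynomial maps of `ℂ^σ` -/

/-- A closed set which meets every line through some point in a countable set is null. -/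
theorem addHaar_eq_zero_of_countable_lines {E : Type} [NormedAddCommGroup E] [NormedSpace ℝ E]
    [FiniteDimensional ℝ E] [MeasurableSpace E] [BorelSpace E] (μ : Measure E) [μ.IsAddHaarMeasure]
    {Z : Set E} (hZ : IsClosed Z) (a : E) (h : ∀ v, {r : ℝ | a + r • v ∈ Z}.Countable) :
    μ Z = 0 := by
  let S : Set (E × ℝ) := {p | a + p.2 • p.1 ∈ Z}
  have hS : MeasurableSet S :=
    (hZ.preimage (f := fun p : E × ℝ => a + p.2 • p.1) (by fun_prop)).measurableSet
  have h1 : (μ.prod volume) S = 0 := by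
    rw [Measure.measure_prod_null hS]
    exact .of_forall fun v => (h v).measure_zero volume
  have h2 := Measure.measure_ae_null_of_prod_null
    (μ := (volume : Measure ℝ)) (ν := μ) (s := Prod.swap ⁻¹' S) (by
      rw [← Measure.prod_swap, Measure.map_apply measurable_swap (measurable_swap hS)]
      exact h1)
  have h3 : ∀ᵐ r : ℝ, r ≠ 0 := by simp [ae_iff]
  -- By Fubini almost every `r` has a null slice `{v | a + r • v ∈ Z}`; for one `r ≠ 0` this slice
  -- is an affine copy of `Z`.
  obtain ⟨r, hr, hr0⟩ := (h2.and h3).exists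
  have h4 : Prod.mk r ⁻¹' (Prod.swap ⁻¹' S) = (fun v => r • v) ⁻¹' ((fun w => a + w) ⁻¹' Z) := rfl
  change μ (Prod.mk r ⁻¹' (Prod.swap ⁻¹' S)) = 0 at hr
  rw [h4, Measure.addHaar_preimage_smul μ hr0, measure_preimage_add] at hr
  simpa [hr0] using hr

/-- On a line through a point where `Q` does not vanish, `Q` restricts to a nonzero polynomial in
one variable, which has finitely many roots. -/
theorem ae_eval_ne_zero {σ : Type} [Fintype σ] {Q : MvPolynomial σ ℂ} (hQ : Q ≠ 0) :
    ∀ᵐ z : σ → ℂ, MvPolynomial.eval z Q ≠ 0 := by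
  obtain ⟨a, ha⟩ : ∃ a, MvPolynomial.eval a Q ≠ 0 := by
    by_contra! h
    exact hQ (MvPolynomial.funext fun x => by simpa using h x)
  rw [ae_iff]
  simp only [not_not]
  refine addHaar_eq_zero_of_countable_lines volume
    (isClosed_eq (MvPolynomial.continuous_eval Q) continuous_const) a fun v => ?_
  let P : Polynomial ℂ := MvPolynomial.aeval (fun i => Polynomial.C (a i) + Polynomial.X *
    Polynomial.C (v i)) Q
  have hP : ∀ r : ℂ, P.eval r = MvPolynomial.eval (a + r • v) Q := by
    intro r
    rw [← Polynomial.coe_evalRingHom, ← MvPolynomial.coe_aeval_eq_eval,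
      ← Polynomial.coe_aeval_eq_evalRingHom]
    simp only [P, RingHom.coe_coe]
    rw [MvPolynomial.comp_aeval_apply]
    congr 2
    ext i
    simp
    ring
  have hP0 : P ≠ 0 := fun h => ha (by simpa [h] using (hP 0).symm)
  have h1 := (P.rootSet_finite ℂ).preimage (f := ((↑) : ℝ → ℂ)) Complex.ofReal_injective.injOn
  refine (h1.subset fun r hr => ?_).countable
  rw [Set.mem_preimage, Polynomial.mem_rootSet]
  refine ⟨hP0, ?_⟩
  rw [Polynomial.coe_aeval_eq_eval, hP, Complex.coe_smul]
  exact hr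

/-- Over a countable field there are only countably many possible relations, and each holds on a
null set. -/
theorem ae_algebraicIndependent {σ F : Type} [Fintype σ] [Field F] [Countable F] [Algebra F ℂ] :
    ∀ᵐ q : σ → ℂ, AlgebraicIndependent F q := by
  have : Countable (MvPolynomial σ F) := by
    rw [← Cardinal.mk_le_aleph0_iff]
    refine MvPolynomial.cardinalMk_le_max.trans ?_
    simp
  have h : ∀ᵐ q : σ → ℂ, ∀ Q : MvPolynomial σ F, Q ≠ 0 → MvPolynomial.aeval q Q ≠ 0 := by
    rw [ae_all_iff]
    intro Q
    by_cases hQ : Q = 0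
    · simp [hQ]
    have hQ' : MvPolynomial.map (algebraMap F ℂ) Q ≠ 0 :=
      (map_ne_zero_iff _ (MvPolynomial.map_injective _ (algebraMap F ℂ).injective)).2 hQ
    filter_upwards [ae_eval_ne_zero hQ'] with z hz _
    rwa [MvPolynomial.eval_map, ← MvPolynomial.aeval_def] at hz
  filter_upwards [h] with q hq
  rw [algebraicIndependent_iff]
  exact fun Q hQ => by_contra fun h0 => hq Q h0 hQ

theorem exists_countable_subfield {σ τ : Type} [Finite τ] (p : τ → MvPolynomial σ ℂ) :
    ∃ F : Subfield ℂ, Countable F ∧ ∃ p₀ : τ → MvPolynomial σ F,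
      ∀ j, MvPolynomial.map (algebraMap F ℂ) (p₀ j) = p j := by
  let S : Set ℂ := ⋃ j, ((p j).coeffs : Set ℂ)
  have hS : S.Countable := Set.countable_iUnion fun j => Finset.countable_toSet _
  refine ⟨Subfield.closure S, ?_, ?_⟩
  · rw [← Cardinal.mk_le_aleph0_iff]
    refine (Subfield.cardinalMk_closure_le_max S).trans ?_
    exact max_le (Cardinal.mk_le_aleph0_iff.2 hS.to_subtype) le_rfl
  · have h : ∀ j, p j ∈ Set.range (MvPolynomial.map (algebraMap (Subfield.closure S) ℂ)) := by
      intro j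
      rw [MvPolynomial.mem_range_map_iff_coeffs_subset]
      exact fun c hc => ⟨⟨c, Subfield.subset_closure (Set.mem_iUnion.2 ⟨j, hc⟩)⟩, rfl⟩
    choose p₀ hp₀ using h
    exact ⟨p₀, hp₀⟩

theorem hasStrictFDerivAt_eval {σ : Type} [Fintype σ] (Q : MvPolynomial σ ℂ) (z : σ → ℂ) :
    HasStrictFDerivAt (fun z => MvPolynomial.eval z Q)
      (∑ j, MvPolynomial.eval z (MvPolynomial.pderiv j Q) •
        (ContinuousLinearMap.proj j : (σ → ℂ) →L[ℂ] ℂ)) z := by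
  classical
  induction Q using MvPolynomial.induction_on with
  | C c =>
    refine ((hasStrictFDerivAt_const (𝕜 := ℂ) c z).congr_fderiv ?_).congr_of_eventuallyEq
      (.of_forall fun w => by simp)
    ext v
    simp [sum_apply, smul_apply]
  | add P Q hP hQ =>
    refine ((hP.fun_add hQ).congr_fderiv ?_).congr_of_eventuallyEq (.of_forall fun w => by simp)
    ext v
    simp [add_mul, Finset.sum_add_distrib, sum_apply, smul_apply]
  | mul_X P i hP =>
    have h1 := hP.mul (hasStrictFDerivAt_apply (𝕜 := ℂ) i z)
    refine (h1.congr_fderiv ?_).congr_of_eventuallyEq (.of_forall fun w => by simp)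
    ext v
    simp only [add_apply, smul_apply, sum_apply,
      ContinuousLinearMap.proj_apply, smul_eq_mul, Derivation.leibniz, MvPolynomial.pderiv_X,
      map_add, map_mul, MvPolynomial.eval_X, add_mul, Finset.sum_add_distrib, Finset.mul_sum]
    congr 1
    · rw [Finset.sum_eq_single i]
      · simp
      · intro j _ hj
        simp [Ne.symm hj]
      · simp
    · exact Finset.sum_congr rfl fun j _ => by ring

/-- The polynomial map of `ℂ^σ` with components `p`. -/
noncomputable def polyMap {σ : Type} (p : σ → MvPolynomial σ ℂ) (z : σ → ℂ) : σ → ℂ :=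
  fun j => MvPolynomial.eval z (p j)

/-- The Jacobian matrix of `polyMap p`. -/
noncomputable def polyJacobian {σ : Type} (p : σ → MvPolynomial σ ℂ) (z : σ → ℂ) : Matrix σ σ ℂ :=
  Matrix.of fun i j => MvPolynomial.eval z (MvPolynomial.pderiv j (p i))

theorem hasStrictFDerivAt_polyMap {σ : Type} [Fintype σ] [DecidableEq σ]
    (p : σ → MvPolynomial σ ℂ) (z : σ → ℂ) :
    HasStrictFDerivAt (polyMap p)
      ((LinearMap.toContinuousLinearMap (polyJacobian p z).mulVecLin).restrictScalars ℝ) z := by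
  refine HasStrictFDerivAt.restrictScalars ℝ (hasStrictFDerivAt_pi'.2 fun j => ?_)
  refine (hasStrictFDerivAt_eval (p j) z).congr_fderiv ?_
  ext v
  simp [polyJacobian, Matrix.mulVec, dotProduct]

/-- The real determinant of a complex-linear map is the norm from `ℂ` to `ℝ` of its complex
determinant. This is the source of `|ω|²`. -/
theorem det_polyJacobian_restrictScalars {σ : Type} [Fintype σ] [DecidableEq σ]
    (A : Matrix σ σ ℂ) :
    ((LinearMap.toContinuousLinearMap A.mulVecLin).restrictScalars ℝ).det = ‖A.det‖ ^ 2 := by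
  have h : (A.mulVecLin.restrictScalars ℝ).det = Algebra.norm ℝ A.mulVecLin.det :=
    LinearMap.det_restrictScalars
  rw [Algebra.norm_complex_apply, Complex.normSq_eq_norm_sq, ← Matrix.toLin'_apply',
    LinearMap.det_toLin'] at h
  exact h

theorem continuous_polyMap {σ : Type} (p : σ → MvPolynomial σ ℂ) : Continuous (polyMap p) :=
  continuous_pi fun j => MvPolynomial.continuous_eval (p j)

/-- By the inverse function theorem the image contains an open set, hence has positive measure,
while a nontrivial relation would confine it to the null zero set of a polynomial. -/
theorem algebraicIndependent_of_det_ne_zero {σ : Type} [Fintype σ] [DecidableEq σ]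
    {p : σ → MvPolynomial σ ℂ} {z : σ → ℂ} (hz : (polyJacobian p z).det ≠ 0) :
    AlgebraicIndependent ℂ p := by
  rw [algebraicIndependent_iff]
  intro Q hQ
  by_contra h0
  have h1 : ∀ w, MvPolynomial.eval (polyMap p w) Q = 0 := by
    intro w
    have h2 : MvPolynomial.aeval w (MvPolynomial.aeval p Q) = 0 := by rw [hQ, map_zero]
    rw [MvPolynomial.comp_aeval_apply] at h2
    exact h2
  let e : (σ → ℂ) ≃L[ℝ] (σ → ℂ) :=
    ((LinearMap.toContinuousLinearMap
      (polyJacobian p z).mulVecLin).restrictScalars ℝ).toContinuousLinearEquivOfDetNeZero (by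
      rw [det_polyJacobian_restrictScalars]; simpa using hz)
  have h2 : HasStrictFDerivAt (polyMap p) (e : (σ → ℂ) →L[ℝ] (σ → ℂ)) z :=
    hasStrictFDerivAt_polyMap p z
  have h3 : Set.range (polyMap p) ∈ nhds (polyMap p z) := by
    rw [← h2.map_nhds_eq_of_equiv]
    exact Filter.range_mem_map
  have h4 := Measure.measure_pos_of_mem_nhds volume h3
  refine h4.ne' (measure_mono_null ?_ (ae_iff.1 (ae_eval_ne_zero h0)))
  rintro _ ⟨w, rfl⟩
  simpa using h1 w

/-- The fibres of a polynomial map of `ℂ^σ` whose Jacobian does not vanish identically almost all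
have the same number of points. -/
theorem exists_ae_encard_fibre {σ : Type} [Fintype σ] [DecidableEq σ]
    {p : σ → MvPolynomial σ ℂ} {z : σ → ℂ} (hz : (polyJacobian p z).det ≠ 0) :
    ∃ N : ℕ, N ≠ 0 ∧ ∀ᵐ q : σ → ℂ, Set.encard {w | polyMap p w = q} = N := by
  -- Countability of the field of definition is what makes generic points a set of full measure.
  obtain ⟨F, hF, p₀, hp₀⟩ := exists_countable_subfield p
  have hind : AlgebraicIndependent F p₀ := by
    have h1 : AlgebraicIndependent F p :=
      (algebraicIndependent_of_det_ne_zero hz).restrictScalars (algebraMap F ℂ).injective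
    refine AlgebraicIndependent.of_comp (MvPolynomial.mapAlgHom (Algebra.ofId F ℂ)) ?_
    convert h1 using 1
    exact funext hp₀
  obtain ⟨N, hN, h⟩ := exists_encard_generic_fibre ℂ hind
  refine ⟨N, hN, ?_⟩
  filter_upwards [ae_algebraicIndependent (σ := σ) (F := F)] with q hq
  rw [← h q hq]
  congr 1
  ext w
  simp only [Set.mem_ofPred_eq, polyMap, funext_iff, ← hp₀, MvPolynomial.eval_map,
    MvPolynomial.aeval_def]

/-! ### The area formula -/

/-- The inverse function theorem gives injectivity near each noncritical point, and the Lindelöf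
property reduces to countably many open sets. The empty set is added so that the family can be
enumerated by `ℕ`. -/
theorem exists_open_injOn_cover {E : Type} [NormedAddCommGroup E] [NormedSpace ℝ E]
    [FiniteDimensional ℝ E] {Φ : E → E} {Φ' : E → E →L[ℝ] E}
    (hΦ : ∀ z, HasStrictFDerivAt Φ (Φ' z) z) :
    ∃ V : ℕ → Set E, (∀ n, IsOpen (V n) ∧ Set.InjOn Φ (V n)) ∧
      {z | (Φ' z).det ≠ 0} ⊆ ⋃ n, V n := by
  have : CompleteSpace E := FiniteDimensional.complete ℝ E
  have : ProperSpace E := FiniteDimensional.proper ℝ E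
  let S : Set (Set E) := {V | IsOpen V ∧ Set.InjOn Φ V}
  obtain ⟨T, hT, hTS, hTU⟩ := TopologicalSpace.isOpen_sUnion_countable S fun V hV => hV.1
  obtain ⟨V, hV⟩ := (hT.insert (∅ : Set E)).exists_eq_range ⟨_, Set.mem_insert _ _⟩
  refine ⟨V, fun n => ?_, fun z hz => ?_⟩
  · have : V n ∈ insert ∅ T := hV ▸ Set.mem_range_self n
    rcases this with h | h
    · simp [h]
    · exact hTS h
  · let e : E ≃L[ℝ] E := (Φ' z).toContinuousLinearEquivOfDetNeZero hz
    have h2 : HasStrictFDerivAt Φ (e : E →L[ℝ] E) z := hΦ z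
    let H := h2.toOpenPartialHomeomorph Φ
    have h3 : H.source ∈ S := ⟨H.open_source, H.injOn⟩
    have h4 : z ∈ ⋃₀ T := by
      rw [hTU]
      exact ⟨_, h3, h2.mem_toOpenPartialHomeomorph_source⟩
    obtain ⟨W, hW, hzW⟩ := h4
    have h5 : W ∈ Set.range V := hV ▸ Set.mem_insert_of_mem _ hW
    obtain ⟨n, rfl⟩ := h5
    exact Set.mem_iUnion.2 ⟨n, hzW⟩

/-- The area formula: a `C¹` map whose fibres almost all have `N` points pushes the measure with
density `|det Φ'|` forward to `N` times Lebesgue measure. -/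
theorem map_withDensity_abs_det {E : Type} [NormedAddCommGroup E] [NormedSpace ℝ E]
    [FiniteDimensional ℝ E] [MeasurableSpace E] [BorelSpace E] (μ : Measure E) [μ.IsAddHaarMeasure]
    {Φ : E → E} {Φ' : E → E →L[ℝ] E} (hΦ : ∀ z, HasStrictFDerivAt Φ (Φ' z) z)
    (hdet : Continuous fun z => (Φ' z).det) {N : ℕ}
    (hN : ∀ᵐ q ∂μ, Set.encard {w | Φ w = q} = N) :
    (μ.withDensity fun z => ENNReal.ofReal |(Φ' z).det|).map Φ = N • μ := by
  have : CompleteSpace E := FiniteDimensional.complete ℝ E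
  have : ProperSpace E := FiniteDimensional.proper ℝ E
  obtain ⟨V, hV, hcov⟩ := exists_open_injOn_cover hΦ
  have hcont : Continuous Φ := continuous_iff_continuousAt.2 fun z => (hΦ z).continuousAt
  let U : Set E := {z | (Φ' z).det ≠ 0}
  have hU : MeasurableSet U := (isOpen_ne_fun hdet continuous_const).measurableSet
  -- The noncritical points are cut into disjoint pieces on which `Φ` is injective, so that the
  -- ordinary change of variables applies to each piece.
  let A : ℕ → Set E := fun n => disjointed V n ∩ U
  have hAm : ∀ n, MeasurableSet (A n) := fun n =>
    (MeasurableSet.disjointed (fun i => (hV i).1.measurableSet) n).inter hU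
  have hAi : ∀ n, Set.InjOn Φ (A n) := fun n =>
    (hV n).2.mono (Set.inter_subset_left.trans (disjointed_subset V n))
  have hAd : Pairwise (Function.onFun Disjoint A) := fun i j hij =>
    (disjoint_disjointed V hij).mono Set.inter_subset_left Set.inter_subset_left
  have hAU : ⋃ n, A n = U := by
    rw [← Set.iUnion_inter, iUnion_disjointed]
    exact Set.inter_eq_right.2 hcov
  have hIm : ∀ n, MeasurableSet (Φ '' A n) := fun n =>
    (hAm n).image_of_continuousOn_injOn hcont.continuousOn (hAi n)
  -- Sard's theorem: the critical values form a null set.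
  have hcrit : ∀ᵐ q ∂μ, q ∉ Φ '' Uᶜ := by
    rw [ae_iff]
    simp only [not_not]
    exact addHaar_image_eq_zero_of_det_fderivWithin_eq_zero μ
      (fun z _ => (hΦ z).hasFDerivAt.hasFDerivWithinAt) fun z hz => by simpa [U] using hz
  have hcount : ∀ᵐ q ∂μ, ∑' n, (Φ '' A n).indicator (fun _ => (1 : ENNReal)) q = N := by
    -- For a regular value each preimage lies in exactly one piece and each piece holds at most one,
    -- so the number of images containing `q` equals the size of the fibre.
    filter_upwards [hN, hcrit] with q hq hqc
    have hfib : ∀ w ∈ {w | Φ w = q}, ∃ n, w ∈ A n := by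
      intro w hw
      have : w ∈ U := by_contra fun h => hqc ⟨w, h, hw⟩
      rw [← hAU] at this
      exact Set.mem_iUnion.1 this
    choose! idx hidx using hfib
    have h1 : idx '' {w | Φ w = q} = {n | q ∈ Φ '' A n} := by
      ext n
      constructor
      · rintro ⟨w, hw, rfl⟩
        exact ⟨w, hidx w hw, hw⟩
      · rintro ⟨w, hw, hwq⟩
        refine ⟨w, hwq, ?_⟩
        by_contra hne
        exact (Set.disjoint_left.1 (hAd hne)) (hidx w hwq) hw
    have h2 : Set.InjOn idx {w | Φ w = q} := by
      intro w hw w' hw' h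
      refine hAi (idx w) (hidx w hw) ?_ (Eq.trans hw (Eq.symm hw'))
      rw [h]
      exact hidx w' hw'
    have h3 : Set.encard {n | q ∈ Φ '' A n} = N := by rw [← h1, h2.encard_image, hq]
    have h4 : ∀ n, (Φ '' A n).indicator (fun _ => (1 : ENNReal)) q =
        {n | q ∈ Φ '' A n}.indicator (fun _ => 1) n := fun n => by
      simp only [Set.indicator, Set.mem_ofPred_eq]
    simp only [h4]
    rw [← tsum_subtype, ENNReal.tsum_set_one, h3]
    simp
  ext B hB
  have hBm : MeasurableSet (Φ ⁻¹' B) := hcont.measurable hB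
  rw [Measure.map_apply hcont.measurable hB, withDensity_apply _ hBm, Measure.smul_apply]
  set d : E → ENNReal := fun z => ENNReal.ofReal |(Φ' z).det| with hd
  have h0 : ∫⁻ z in Φ ⁻¹' B, d z ∂μ = ∫⁻ z in ⋃ n, (A n ∩ Φ ⁻¹' B), d z ∂μ := by
    rw [← Set.iUnion_inter, hAU, ← lintegral_indicator hBm,
      ← lintegral_indicator (hU.inter hBm)]
    congr 1
    ext z
    by_cases hz : z ∈ U
    · by_cases hb : z ∈ Φ ⁻¹' B
      · rw [Set.indicator_of_mem hb, Set.indicator_of_mem (Set.mem_inter hz hb)]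
      · rw [Set.indicator_of_notMem hb, Set.indicator_of_notMem fun h => hb h.2]
    · have : d z = 0 := by
        have : (Φ' z).det = 0 := by simpa [U] using hz
        simp [hd, this]
      simp [Set.indicator, this]
  rw [h0, lintegral_iUnion (fun n => (hAm n).inter hBm)
    (fun i j hij => (hAd hij).mono Set.inter_subset_left Set.inter_subset_left)]
  have h1 : ∀ n, ∫⁻ z in A n ∩ Φ ⁻¹' B, d z ∂μ =
      ∫⁻ q in B, (Φ '' A n).indicator (fun _ => (1 : ENNReal)) q ∂μ := by
    intro n
    rw [hd, lintegral_abs_det_fderiv_eq_addHaar_image μ ((hAm n).inter hBm)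
      (fun z _ => (hΦ z).hasFDerivAt.hasFDerivWithinAt) ((hAi n).mono Set.inter_subset_left),
      Set.image_inter_preimage, lintegral_indicator_const (hIm n), one_mul,
      Measure.restrict_apply (hIm n)]
  simp only [h1]
  rw [← lintegral_tsum (fun n => (measurable_const.indicator (hIm n)).aemeasurable),
    lintegral_congr_ae (ae_restrict_of_ae hcount)]
  simp

theorem continuous_det_polyJacobian {σ : Type} [Fintype σ] [DecidableEq σ]
    (p : σ → MvPolynomial σ ℂ) : Continuous fun z => (polyJacobian p z).det :=
  Continuous.matrix_det (continuous_matrix fun _ _ => MvPolynomial.continuous_eval _)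

/-- A polynomial map of `ℂ^σ` whose Jacobian does not vanish identically has almost everywhere a
constant number of preimages, and satisfies the corresponding change of variables formula. -/
theorem exists_degree_polyMap {σ : Type} [Fintype σ] [DecidableEq σ]
    {p : σ → MvPolynomial σ ℂ} {z : σ → ℂ} (hz : (polyJacobian p z).det ≠ 0) :
    ∃ N : ℕ, N ≠ 0 ∧ (∀ᵐ q : σ → ℂ, Set.encard {w | polyMap p w = q} = N) ∧
      ∀ G : (σ → ℂ) → ℂ, Integrable G →
        Integrable (fun w => (‖(polyJacobian p w).det‖ ^ 2 : ℝ) • G (polyMap p w)) ∧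
        ∫ w, (‖(polyJacobian p w).det‖ ^ 2 : ℝ) • G (polyMap p w) = N * ∫ q, G q := by
  obtain ⟨N, hN, h⟩ := exists_ae_encard_fibre hz
  refine ⟨N, hN, h, fun G hG => ?_⟩
  have hc := continuous_det_polyJacobian p
  have h1 := map_withDensity_abs_det volume (hasStrictFDerivAt_polyMap p) (by
    simp only [det_polyJacobian_restrictScalars]
    fun_prop) h
  simp only [det_polyJacobian_restrictScalars, abs_pow, abs_norm] at h1
  have hm : Measurable fun w => Real.toNNReal (‖(polyJacobian p w).det‖ ^ 2) :=
    (hc.norm.pow 2).measurable.real_toNNReal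
  have hG' : Integrable G (N • volume) := by
    rw [← Nat.cast_smul_eq_nsmul ENNReal]
    exact hG.smul_measure (ENNReal.natCast_ne_top N)
  rw [← h1] at hG'
  have h2 : Integrable (fun w => G (polyMap p w))
      (volume.withDensity fun w =>
        ((Real.toNNReal (‖(polyJacobian p w).det‖ ^ 2) : NNReal) : ENNReal)) :=
    (integrable_map_measure hG'.aestronglyMeasurable
      (continuous_polyMap p).measurable.aemeasurable).1 hG'
  have h3 := (integrable_withDensity_iff_integrable_smul hm).1 h2
  have h4 : ∀ w, Real.toNNReal (‖(polyJacobian p w).det‖ ^ 2) • G (polyMap p w) =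
      (‖(polyJacobian p w).det‖ ^ 2 : ℝ) • G (polyMap p w) := fun w => by
    rw [NNReal.smul_def, Real.coe_toNNReal _ (by positivity)]
  simp only [h4] at h3
  refine ⟨h3, ?_⟩
  have h5 : ∫ q, G q ∂((volume.withDensity fun w =>
      ENNReal.ofReal (‖(polyJacobian p w).det‖ ^ 2)).map (polyMap p)) = N * ∫ q, G q := by
    rw [h1, ← Nat.cast_smul_eq_nsmul ENNReal, integral_smul_measure]
    simp
  rw [integral_map (continuous_polyMap p).measurable.aemeasurable hG'.aestronglyMeasurable] at h5
  rw [← h5]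
  have h6 := integral_withDensity_eq_integral_smul hm (fun w => G (polyMap p w)) (μ := volume)
  simp only [h4] at h6
  exact h6.symm

/-! ### The Fourier transform on `ℂ^ι` -/

/-- Both measures are Haar measures, hence proportional; the Gaussian has integral `π ^ card ι` for
each, so the factor is one. -/
theorem measurePreserving_ofLp_complex (ι : Type) [Fintype ι] :
    MeasurePreserving (PiLp.continuousLinearEquiv 2 ℝ (fun _ : ι => ℂ)) := by
  let e := PiLp.continuousLinearEquiv 2 ℝ (fun _ : ι => ℂ)
  have hem : Measurable e := e.continuous.measurable
  let ν : Measure (ι → ℂ) := Measure.map e volume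
  have : ν.IsAddHaarMeasure := e.isAddHaarMeasure_map volume
  obtain ⟨c, hc⟩ : ∃ c : NNReal, ν = c • (volume : Measure (ι → ℂ)) :=
    ⟨_, Measure.isAddLeftInvariant_eq_smul ν volume⟩
  let g : (ι → ℂ) → ℝ := fun z => ∏ i, Real.exp (-‖z i‖ ^ (2 : ℝ))
  have h1 : ∫ z, g z = Real.pi ^ Fintype.card ι := by
    rw [integral_fintype_prod_volume_eq_pow (fun z : ℂ => Real.exp (-‖z‖ ^ (2 : ℝ))),
      Complex.integral_exp_neg_rpow (by norm_num)]
    norm_num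
  have h2 : ∫ z, g z ∂ν = Real.pi ^ Fintype.card ι := by
    have h3 : ν = Measure.map e.toHomeomorph.toMeasurableEquiv volume := rfl
    rw [h3, integral_map_equiv e.toHomeomorph.toMeasurableEquiv]
    have h4 : ∀ v : EuclideanSpace ℂ ι, g (e v) = Real.exp (-1 * ‖v‖ ^ 2) := by
      intro v
      simp only [g, ← Real.exp_sum, EuclideanSpace.norm_sq_eq, Finset.sum_neg_distrib,
        Real.rpow_two, neg_mul, one_mul]
      rfl
    refine (integral_congr_ae (.of_forall h4)).trans ?_
    rw [GaussianFourier.integral_rexp_neg_mul_sq_norm one_pos, div_one]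
    have h5 : Module.finrank ℝ (EuclideanSpace ℂ ι) = 2 * Fintype.card ι := by
      rw [finrank_real_of_complex, finrank_euclideanSpace]
    rw [h5, Nat.cast_mul, Nat.cast_two, mul_div_cancel_left₀ _ two_ne_zero, Real.rpow_natCast]
  have h3 : (c : ℝ) = 1 := by
    rw [hc, integral_smul_nnreal_measure, h1, NNReal.smul_def, smul_eq_mul] at h2
    exact mul_eq_right₀ (by positivity) |>.1 h2
  refine ⟨hem, ?_⟩
  change ν = volume
  rw [hc, NNReal.coe_eq_one.1 h3, one_smul]

/-- The real-linear map `s ↦ -(2π)⁻¹ s̄`, which turns `exp (i Re ⟨s, ξ⟩)` into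
`exp (-2πi (ξ, ·))`. -/
noncomputable def fourierScaling (ι : Type) [Fintype ι] : (ι → ℂ) ≃L[ℝ] EuclideanSpace ℂ ι :=
  ((ContinuousLinearEquiv.piCongrRight fun _ => Complex.conjCLE).trans
    (ContinuousLinearEquiv.smulLeft (Units.mk0 (-(2 * Real.pi)⁻¹ : ℝ)
      (by simp [Real.pi_ne_zero])))).trans (PiLp.continuousLinearEquiv 2 ℝ (fun _ : ι => ℂ)).symm

theorem inner_fourierScaling {ι : Type} [Fintype ι] (v : EuclideanSpace ℂ ι) (s : ι → ℂ) :
    inner ℝ v (fourierScaling ι s) =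
      -(2 * Real.pi)⁻¹ * (s ⬝ᵥ PiLp.continuousLinearEquiv 2 ℝ (fun _ : ι => ℂ) v).re := by
  have h3 : ∀ i, (fourierScaling ι s) i = -(2 * Real.pi : ℂ)⁻¹ * (starRingEnd ℂ) (s i) :=
    fun i => by
      change (-(2 * Real.pi)⁻¹ : ℝ) • (starRingEnd ℂ) (s i) = _
      rw [Complex.real_smul]; push_cast; ring
  have h4 : ∀ i, (PiLp.continuousLinearEquiv 2 ℝ (fun _ : ι => ℂ) v) i = v i := fun i => rfl
  rw [PiLp.inner_apply]
  simp only [dotProduct, Complex.re_sum, Finset.mul_sum, h3, h4, Complex.inner]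
  refine Finset.sum_congr rfl fun i _ => ?_
  rw [mul_assoc, ← map_mul, ← Complex.conj_re (s i * v i)]
  have : (-(2 * Real.pi : ℂ)⁻¹) = ((-(2 * Real.pi)⁻¹ : ℝ) : ℂ) := by push_cast; ring
  rw [this, Complex.re_ofReal_mul]

/-- The Fourier transform `s ↦ ∫ χ(ξ) exp (i Re ⟨s, ξ⟩) dξ` as a continuous linear map. -/
noncomputable def fourierCLM (ι : Type) [Fintype ι] : 𝓢(ι → ℂ, ℂ) →L[ℂ] 𝓢(ι → ℂ, ℂ) :=
  (SchwartzMap.compCLMOfContinuousLinearEquiv ℂ (fourierScaling ι)).comp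
    ((FourierTransform.fourierCLM ℂ 𝓢(EuclideanSpace ℂ ι, ℂ)).comp
      (SchwartzMap.compCLMOfContinuousLinearEquiv ℂ
        (PiLp.continuousLinearEquiv 2 ℝ (fun _ : ι => ℂ))))

theorem fourierCLM_apply {ι : Type} [Fintype ι] (χ : 𝓢(ι → ℂ, ℂ)) (s : ι → ℂ) :
    fourierCLM ι χ s = ∫ ξ, χ ξ * Complex.exp (Complex.I * ((s ⬝ᵥ ξ).re : ℂ)) := by
  let e := PiLp.continuousLinearEquiv 2 ℝ (fun _ : ι => ℂ)
  rw [← (measurePreserving_ofLp_complex ι).integral_comp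
    e.toHomeomorph.measurableEmbedding]
  simp only [fourierCLM, ContinuousLinearMap.comp_apply, FourierTransform.fourierCLM_apply,
    SchwartzMap.compCLMOfContinuousLinearEquiv_apply, Function.comp,
    SchwartzMap.fourier_coe, Real.fourier_eq']
  refine integral_congr_ae (.of_forall fun v => ?_)
  change _ • χ (e v) = χ (e v) * _
  rw [smul_eq_mul, mul_comm]
  congr 2
  rw [mul_comm Complex.I]
  congr 2
  rw [inner_fourierScaling]
  field_simp

/-- This is Euclidean Fourier inversion after the substitution `s ↦ -(2π)⁻¹ s̄`. Conjugation
preserves volume, and the scaling in real dimension `2 * card ι` produces the constant. -/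
theorem fourierCLM_inversion {ι : Type} [Fintype ι] (χ : 𝓢(ι → ℂ, ℂ)) (ξ : ι → ℂ) :
    ∫ s, fourierCLM ι χ s * Complex.exp (-(Complex.I * ((s ⬝ᵥ ξ).re : ℂ))) =
      ((2 * Real.pi : ℝ) ^ (2 * Fintype.card ι) : ℂ) * χ ξ := by
  let e := PiLp.continuousLinearEquiv 2 ℝ (fun _ : ι => ℂ)
  let χ' : 𝓢(EuclideanSpace ℂ ι, ℂ) := SchwartzMap.compCLMOfContinuousLinearEquiv ℂ e χ
  let cj : (ι → ℂ) ≃ᵐ (ι → ℂ) :=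
    (ContinuousLinearEquiv.piCongrRight (R₁ := ℝ) fun _ : ι =>
      Complex.conjCLE).toHomeomorph.toMeasurableEquiv
  have hcj : MeasurePreserving cj := by
    change MeasurePreserving (fun (a : ι → ℂ) i => Complex.conjLIE (a i)) volume volume
    exact volume_preserving_pi fun _ => Complex.conjLIE.measurePreserving
  let g : EuclideanSpace ℂ ι → ℂ := fun v => FourierTransform.fourier χ' v *
    Complex.exp (2 * Real.pi * (inner ℝ v (e.symm ξ) : ℝ) * Complex.I)
  have h1 : ∀ s, fourierCLM ι χ s * Complex.exp (-(Complex.I * ((s ⬝ᵥ ξ).re : ℂ))) =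
      g (e.symm ((-(2 * Real.pi)⁻¹ : ℝ) • cj s)) := by
    intro s
    have h2 : e.symm ((-(2 * Real.pi)⁻¹ : ℝ) • cj s) = fourierScaling ι s := rfl
    have h0 : fourierCLM ι χ s = FourierTransform.fourier χ' (fourierScaling ι s) := rfl
    rw [h2, h0]
    simp only [g]
    rw [real_inner_comm, inner_fourierScaling]
    congr 2
    have : e (e.symm ξ) = ξ := e.apply_symm_apply ξ
    rw [this]
    push_cast
    have := Real.pi_ne_zero
    field_simp
  simp only [h1]
  rw [hcj.integral_comp cj.measurableEmbedding
      (fun s => g (e.symm ((-(2 * Real.pi)⁻¹ : ℝ) • s))),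
    Measure.integral_comp_smul volume (fun s => g (e.symm s)),
    ← (measurePreserving_ofLp_complex ι).integral_comp e.toHomeomorph.measurableEmbedding]
  have h3 : ∀ v, e.symm (PiLp.continuousLinearEquiv 2 ℝ (fun _ : ι => ℂ) v) = v :=
    fun v => e.symm_apply_apply v
  simp only [h3]
  have h4 : ∫ v, g v = χ ξ := by
    have h5 : FourierTransformInv.fourierInv (FourierTransform.fourier χ') = χ' :=
      FourierTransform.fourierInv_fourier_eq χ'
    have h6 : χ' (e.symm ξ) = χ ξ := by
      change χ (e (e.symm ξ)) = χ ξ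
      rw [e.apply_symm_apply]
    rw [← h6, ← congrArg (fun h : 𝓢(EuclideanSpace ℂ ι, ℂ) => h (e.symm ξ)) h5]
    simp only [SchwartzMap.fourierInv_coe, Real.fourierInv_eq']
    refine integral_congr_ae (.of_forall fun v => ?_)
    simp only [g, smul_eq_mul]
    rw [mul_comm]
    push_cast
    rfl
  rw [h4]
  have h5 : Module.finrank ℝ (ι → ℂ) = 2 * Fintype.card ι := by
    rw [finrank_real_of_complex, Module.finrank_fintype_fun_eq_card]
  rw [h5, Complex.real_smul, (even_two_mul _).neg_pow, inv_pow, inv_inv,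
    abs_of_nonneg (by positivity)]
  push_cast
  rfl

theorem fourierCLM_surjective (ι : Type) [Fintype ι] : Function.Surjective (fourierCLM ι) := by
  intro P
  let n : 𝓢(ι → ℂ, ℂ) →L[ℂ] 𝓢(ι → ℂ, ℂ) :=
    SchwartzMap.compCLMOfContinuousLinearEquiv ℂ (ContinuousLinearEquiv.neg ℝ)
  let C : ℂ := ((2 * Real.pi : ℝ) ^ (2 * Fintype.card ι) : ℂ)
  have hC : C ≠ 0 := by simp [C, Real.pi_ne_zero]
  refine ⟨C⁻¹ • n (fourierCLM ι P), ?_⟩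
  ext s
  rw [map_smul, smul_apply, fourierCLM_apply, smul_eq_mul, inv_mul_eq_iff_eq_mul₀ hC,
    ← fourierCLM_inversion, ← integral_neg_eq_self]
  refine integral_congr_ae (.of_forall fun ξ => ?_)
  have h1 : n (fourierCLM ι P) (-ξ) = fourierCLM ι P ξ := by
    change fourierCLM ι P (- -ξ) = _
    rw [neg_neg]
  simp only [h1, dotProduct_neg, Complex.neg_re, Complex.ofReal_neg, mul_neg, dotProduct_comm s ξ]

theorem fourierSchwartz_eq {l : ℕ} (χ : 𝓢(Fin l → ℂ, ℂ)) :
    fourierSchwartz χ = fourierCLM (Fin l) χ := by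
  ext s
  exact (fourierCLM_apply χ s).symm

/-! ### Approximation by compactly supported functions, and translations -/

theorem norm_iteratedFDeriv_comp_smul_le {E : Type} [NormedAddCommGroup E] [NormedSpace ℝ E]
    {h : E → ℝ} (hh : ContDiff ℝ (⊤ : ℕ∞) h) {r : ℝ} (hr0 : 0 ≤ r) (hr1 : r ≤ 1) (i : ℕ) (x : E) :
    ‖iteratedFDeriv ℝ i (fun y => h (r • y)) x‖ ≤ ‖iteratedFDeriv ℝ i h (r • x)‖ := by
  let g : E →L[ℝ] E := r • ContinuousLinearMap.id ℝ E
  have hg : ‖g‖ ≤ 1 := by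
    refine ContinuousLinearMap.opNorm_le_bound _ zero_le_one fun y => ?_
    have : g y = r • y := rfl
    rw [this, norm_smul, Real.norm_of_nonneg hr0]
    gcongr
  have h1 : iteratedFDeriv ℝ i (fun y => h (r • y)) x = _ :=
    g.iteratedFDeriv_comp_right hh x (i := i) (mod_cast le_top)
  rw [h1]
  refine (ContinuousMultilinearMap.norm_compContinuousLinearMap_le _ _).trans ?_
  refine mul_le_of_le_one_right (norm_nonneg _) ?_
  exact Finset.prod_le_one (fun _ _ => norm_nonneg _) fun _ _ => hg

/-- Schwartz functions are approximated by their products with cut-off functions. -/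
theorem exists_tendsto_compactSupport {E : Type} [NormedAddCommGroup E] [NormedSpace ℝ E]
    [FiniteDimensional ℝ E] (R : 𝓢(E, ℂ)) :
    ∃ R' : ℕ → 𝓢(E, ℂ), (∀ j, HasCompactSupport (R' j)) ∧ (∀ j x, ‖R' j x‖ ≤ ‖R x‖) ∧
      Filter.Tendsto R' Filter.atTop (nhds R) := by
  let b : ContDiffBump (0 : E) := ⟨1, 2, one_pos, one_lt_two⟩
  have hb : ContDiff ℝ (⊤ : ℕ∞) b := b.contDiff
  let r : ℕ → ℝ := fun j => ((j : ℝ) + 1)⁻¹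
  have hr0 : ∀ j, 0 < r j := fun j => by positivity
  have hr1 : ∀ j, r j ≤ 1 := fun j => inv_le_one_of_one_le₀ (by simp)
  have hsupp : ∀ j, HasCompactSupport fun x => b (r j • x) := fun j =>
    b.hasCompactSupport.comp_homeomorph (Homeomorph.smulOfNeZero (r j) (hr0 j).ne')
  have hsm : ∀ j, ContDiff ℝ (⊤ : ℕ∞) fun x => b (r j • x) := fun j =>
    hb.comp (contDiff_const_smul (r j))
  have hsuppR : ∀ j, HasCompactSupport fun x => b (r j • x) • R x := fun j => (hsupp j).smul_right
  let R' : ℕ → 𝓢(E, ℂ) := fun j =>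
    (hsuppR j).toSchwartzMap ((hsm j).smul (R.smooth ⊤))
  have hR' : ∀ j x, R' j x = b (r j • x) • R x := fun j x => rfl
  refine ⟨R', hsuppR, fun j x => ?_, ?_⟩
  · rw [hR', norm_smul, Real.norm_of_nonneg b.nonneg]
    exact mul_le_of_le_one_left (norm_nonneg _) b.le_one
  rw [(schwartz_withSeminorms ℝ E ℂ).tendsto_nhds]
  rintro ⟨k, n⟩
  let h : E → ℝ := fun x => b x - 1
  have hh : ContDiff ℝ (⊤ : ℕ∞) h := hb.sub contDiff_const
  have hbound : ∀ i, ∃ C, 0 ≤ C ∧ ∀ x, ‖iteratedFDeriv ℝ i h x‖ ≤ C := by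
    intro i
    have h1 : Continuous (iteratedFDeriv ℝ i b) := hb.continuous_iteratedFDeriv (mod_cast le_top)
    obtain ⟨C, hC⟩ := h1.bounded_above_of_compact_support (b.hasCompactSupport.iteratedFDeriv i)
    have hC0 : 0 ≤ C := (norm_nonneg _).trans (hC 0)
    refine ⟨C + 1, by positivity, fun x => ?_⟩
    have h2 : iteratedFDeriv ℝ i h x =
        iteratedFDeriv ℝ i b x - iteratedFDeriv ℝ i (fun _ => (1 : ℝ)) x := by
      refine iteratedFDeriv_sub_apply (hb.of_le (mod_cast le_top)).contDiffAt contDiffAt_const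
    rw [h2]
    refine (norm_sub_le _ _).trans (add_le_add (hC x) ?_)
    rcases eq_or_ne i 0 with rfl | hi
    · simp
    · simp [iteratedFDeriv_const_of_ne hi]
  choose C hC0 hC using hbound
  let K : ℝ := ∑ i ∈ Finset.range (n + 1),
    (n.choose i : ℝ) * (C i * SchwartzMap.seminorm ℝ (k + 1) (n - i) R)
  have hK : 0 ≤ K := Finset.sum_nonneg fun i _ =>
    mul_nonneg (Nat.cast_nonneg _) (mul_nonneg (hC0 i) (apply_nonneg _ _))
  have key : ∀ j, SchwartzMap.seminorm ℝ k n (R' j - R) ≤ r j * K := by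
    intro j
    refine SchwartzMap.seminorm_le_bound ℝ k n _ (mul_nonneg (hr0 j).le hK) fun x => ?_
    have hfun : ⇑(R' j - R) = fun y => (fun y => h (r j • y)) y • R y := by
      ext y
      simp [hR', h, sub_smul]
    rw [hfun]
    have hhj : ContDiff ℝ (⊤ : ℕ∞) fun y => h (r j • y) := hh.comp (contDiff_const_smul (r j))
    have h1 := norm_iteratedFDeriv_smul_le (n := n) hhj (R.smooth ⊤) x (mod_cast le_top)
    -- Where `‖x‖ * r j < 1` the cut-off is locally one and the difference vanishes. Elsewhere `1 ≤
    -- ‖x‖ * r j`, so one more power of `‖x‖` in the seminorm buys the small factor `r j`.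
    by_cases hx : ‖x‖ * r j < 1
    · have h0 : (fun y => (fun y => h (r j • y)) y • R y) =ᶠ[nhds x] fun _ => 0 := by
        have : ∀ᶠ y in nhds x, ‖y‖ * r j < 1 :=
          (continuous_norm.mul continuous_const).continuousAt.eventually_lt continuousAt_const hx
        filter_upwards [this] with y hy
        have : b (r j • y) = 1 := by
          refine b.one_of_mem_closedBall ?_
          rw [mem_closedBall_zero_iff, norm_smul, Real.norm_of_nonneg (hr0 j).le, mul_comm]
          exact hy.le
        simp [h, this]
      have h2 := (h0.iteratedFDeriv ℝ n).eq_of_nhds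
      rw [h2]
      have : iteratedFDeriv ℝ n (fun _ : E => (0 : ℂ)) x = 0 := by
        rw [iteratedFDeriv_fun_zero]; rfl
      rw [this, norm_zero, mul_zero]
      exact mul_nonneg (hr0 j).le hK
    · push Not at hx
      calc ‖x‖ ^ k * _ ≤ ‖x‖ ^ k * _ := mul_le_mul_of_nonneg_left h1 (by positivity)
        _ ≤ _ := by
          simp only [K, Finset.mul_sum]
          refine Finset.sum_le_sum fun i _ => ?_
          have h3 : ‖iteratedFDeriv ℝ i (fun y => h (r j • y)) x‖ ≤ C i :=
            (norm_iteratedFDeriv_comp_smul_le hh (hr0 j).le (hr1 j) i x).trans (hC i _)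
          have h4 : ‖x‖ ^ k * ‖iteratedFDeriv ℝ (n - i) R x‖ ≤
              r j * SchwartzMap.seminorm ℝ (k + 1) (n - i) R := by
            calc ‖x‖ ^ k * ‖iteratedFDeriv ℝ (n - i) R x‖
                ≤ (‖x‖ * r j) * (‖x‖ ^ k * ‖iteratedFDeriv ℝ (n - i) R x‖) :=
                  le_mul_of_one_le_left (by positivity) hx
              _ = r j * (‖x‖ ^ (k + 1) * ‖iteratedFDeriv ℝ (n - i) R x‖) := by ring
              _ ≤ _ := mul_le_mul_of_nonneg_left (SchwartzMap.le_seminorm ℝ _ _ R x) (hr0 j).le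
          calc ‖x‖ ^ k * ((n.choose i : ℝ) * ‖iteratedFDeriv ℝ i (fun y => h (r j • y)) x‖ *
                ‖iteratedFDeriv ℝ (n - i) R x‖)
              = (n.choose i : ℝ) * (‖iteratedFDeriv ℝ i (fun y => h (r j • y)) x‖ *
                (‖x‖ ^ k * ‖iteratedFDeriv ℝ (n - i) R x‖)) := by ring
            _ ≤ (n.choose i : ℝ) * (C i * (r j * SchwartzMap.seminorm ℝ (k + 1) (n - i) R)) := by
                gcongr
                exact hC0 i
            _ = _ := by ring
  have hlim : Filter.Tendsto (fun j => r j * K) Filter.atTop (nhds 0) := by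
    have : Filter.Tendsto r Filter.atTop (nhds 0) := by
      simpa [r] using tendsto_one_div_add_atTop_nhds_zero_nat (𝕜 := ℝ)
    simpa using this.mul_const K
  intro ε hε
  filter_upwards [hlim.eventually_lt_const hε] with j hj
  exact (key j).trans_lt hj

theorem seminorm_finset_sup_apply_le_sum {V ι : Type} [AddCommGroup V] [Module ℂ V]
    (p : ι → Seminorm ℂ V) (s : Finset ι) (g : V) : s.sup p g ≤ ∑ i ∈ s, p i g :=
  Seminorm.finset_sup_apply_le (Finset.sum_nonneg fun _ _ => apply_nonneg _ _) fun _ hi =>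
    Finset.single_le_sum (f := fun i => p i g) (fun _ _ => apply_nonneg _ _) hi

/-- A tempered distribution grows at most polynomially along translations, locally uniformly in the
test function. -/
theorem norm_temperedDistribution_translate_le {E : Type} [NormedAddCommGroup E] [NormedSpace ℝ E]
    (a : 𝓢'(E, ℂ)) :
    ∃ (K : ℕ) (q : 𝓢(E, ℂ) → ℝ), Continuous q ∧
      ∀ (v : E) (g : 𝓢(E, ℂ)), ‖a (SchwartzMap.compSubConstCLM ℂ v g)‖ ≤ (1 + ‖v‖) ^ K * q g := by
  let N : Seminorm ℂ 𝓢(E, ℂ) := (normSeminorm ℂ ℂ).comp a.toLinearMap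
  have hN : Continuous N := continuous_norm.comp a.continuous
  obtain ⟨s, C, -, hC⟩ := Seminorm.bound_of_continuous (schwartz_withSeminorms ℂ E ℂ) N hN
  let p : ℕ × ℕ → Seminorm ℂ 𝓢(E, ℂ) := fun m => SchwartzMap.seminorm ℂ m.1 m.2
  -- Translation by `v` costs a factor `(1 + ‖v‖) ^ m` in a seminorm of weight `m`, so `K` is the
  -- largest weight among the seminorms that control `a`.
  let K : ℕ := s.sup Prod.fst
  let q : 𝓢(E, ℂ) → ℝ := fun g => (C : ℝ) * ∑ m ∈ s, 2 ^ m.1 * ∑ i ∈ Finset.Iic m, p i g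
  have hpc : ∀ i, Continuous (p i) := (schwartz_withSeminorms ℂ E ℂ).continuous_seminorm
  refine ⟨K, q, ?_, fun v g => ?_⟩
  · exact continuous_const.mul (continuous_finsetSum _ fun m _ => continuous_const.mul
      (continuous_finsetSum _ fun i _ => hpc i))
  have hm : ∀ m ∈ s, p m (SchwartzMap.compSubConstCLM ℂ v g) ≤
      (1 + ‖v‖) ^ K * (2 ^ m.1 * ∑ i ∈ Finset.Iic m, p i g) := by
    intro m hms
    have hmK : m.1 ≤ K := Finset.le_sup (f := Prod.fst) hms
    have hp0 : ∀ i, 0 ≤ p i g := fun i => apply_nonneg _ _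
    refine SchwartzMap.seminorm_le_bound ℂ _ _ _ (by positivity) fun x => ?_
    have h1 : ⇑(SchwartzMap.compSubConstCLM ℂ v g) = fun y => g (y - v) := rfl
    rw [h1, iteratedFDeriv_comp_sub]
    have h2 : ‖x‖ ≤ (1 + ‖v‖) * (1 + ‖x - v‖) := by
      have : ‖x‖ ≤ ‖x - v‖ + ‖v‖ := by simpa using norm_add_le (x - v) v
      nlinarith [norm_nonneg v, norm_nonneg (x - v),
        mul_nonneg (norm_nonneg v) (norm_nonneg (x - v))]
    calc ‖x‖ ^ m.1 * ‖iteratedFDeriv ℝ m.2 g (x - v)‖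
        ≤ ((1 + ‖v‖) * (1 + ‖x - v‖)) ^ m.1 * ‖iteratedFDeriv ℝ m.2 g (x - v)‖ := by gcongr
      _ = (1 + ‖v‖) ^ m.1 * ((1 + ‖x - v‖) ^ m.1 * ‖iteratedFDeriv ℝ m.2 g (x - v)‖) := by
          rw [mul_pow]; ring
      _ ≤ (1 + ‖v‖) ^ K * (2 ^ m.1 * ∑ i ∈ Finset.Iic m, p i g) := by
          refine mul_le_mul (pow_le_pow_right₀ (by linarith [norm_nonneg v]) hmK) ?_
            (by positivity) (by positivity)
          refine (SchwartzMap.one_add_le_sup_seminorm_apply (𝕜 := ℂ) (m := m) le_rfl le_rfl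
            g (x - v)).trans ?_
          gcongr
          exact seminorm_finset_sup_apply_le_sum p (Finset.Iic m) g
  calc ‖a (SchwartzMap.compSubConstCLM ℂ v g)‖
      ≤ (C • s.sup p) (SchwartzMap.compSubConstCLM ℂ v g) := hC _
    _ = C * (s.sup p) (SchwartzMap.compSubConstCLM ℂ v g) := rfl
    _ ≤ C * ∑ m ∈ s, p m (SchwartzMap.compSubConstCLM ℂ v g) := by
        gcongr
        exact seminorm_finset_sup_apply_le_sum p s _
    _ ≤ C * ∑ m ∈ s, (1 + ‖v‖) ^ K * (2 ^ m.1 * ∑ i ∈ Finset.Iic m, p i g) := by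
        gcongr with m hms
        exact hm m hms
    _ = (1 + ‖v‖) ^ K * q g := by
        simp only [q, ← Finset.mul_sum]
        ring

/-! ### Convolution of a tempered distribution with a Schwartz function -/

/-- The plane wave `exp (i Re ⟨s, ξ⟩)`. -/
noncomputable def planeWave {ι : Type} [Fintype ι] (s ξ : ι → ℂ) : ℂ :=
  Complex.exp (Complex.I * ((s ⬝ᵥ ξ).re : ℂ))

section PlaneWave

variable {ι : Type} [Fintype ι]

theorem norm_planeWave (s ξ : ι → ℂ) : ‖planeWave s ξ‖ = 1 := by
  rw [planeWave, mul_comm]; exact Complex.norm_exp_ofReal_mul_I _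

theorem planeWave_add (s s' ξ : ι → ℂ) :
    planeWave (s + s') ξ = planeWave s ξ * planeWave s' ξ := by
  simp only [planeWave, ← Complex.exp_add, add_dotProduct, Complex.add_re, Complex.ofReal_add,
    mul_add]

theorem planeWave_neg (s ξ : ι → ℂ) :
    planeWave (-s) ξ = Complex.exp (-(Complex.I * ((s ⬝ᵥ ξ).re : ℂ))) := by
  simp [planeWave]

theorem planeWave_mul_neg (s ξ : ι → ℂ) : planeWave s ξ * planeWave (-s) ξ = 1 := by
  rw [← planeWave_add]
  simp [planeWave]

theorem continuous_planeWave :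
    Continuous fun p : (ι → ℂ) × (ι → ℂ) => planeWave p.1 p.2 := by
  unfold planeWave dotProduct
  fun_prop

theorem contDiff_planeWave (s : ι → ℂ) : ContDiff ℝ (⊤ : ℕ∞) fun ξ => planeWave s ξ := by
  let L : (ι → ℂ) →L[ℝ] ℂ := ∑ i, s i • (ContinuousLinearMap.proj (R := ℝ) i)
  have h : (fun ξ => planeWave s ξ) = fun ξ =>
      Complex.exp (Complex.I * Complex.ofRealCLM (Complex.reCLM (L ξ))) := by
    ext ξ
    simp [planeWave, L, dotProduct, sum_apply]
  rw [h]
  exact (contDiff_const.mul (Complex.ofRealCLM.contDiff.comp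
    (Complex.reCLM.contDiff.comp L.contDiff))).cexp

/-- The Fourier transform of an integrable function is continuous. -/
theorem continuous_integral_mul_planeWave {h : (ι → ℂ) → ℂ} (hh : Integrable h) :
    Continuous fun s => ∫ ξ, h ξ * planeWave s ξ := by
  refine continuous_of_dominated (bound := fun ξ => ‖h ξ‖) (fun s => ?_) (fun s => ?_) hh.norm ?_
  · exact hh.aestronglyMeasurable.mul
      (continuous_planeWave.comp (by fun_prop : Continuous fun ξ => (s, ξ))).aestronglyMeasurable
  · exact .of_forall fun ξ => by rw [norm_mul, norm_planeWave, mul_one]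
  · exact .of_forall fun ξ => continuous_const.mul
      (continuous_planeWave.comp (by fun_prop : Continuous fun s => (s, ξ)))

theorem integral_mul_integral_planeWave_swap {f h : (ι → ℂ) → ℂ} (hf : Integrable f)
    (hh : Integrable h) :
    ∫ s, (∫ ξ, h ξ * planeWave (-s) ξ) * f s = ∫ ξ, h ξ * ∫ s, f s * planeWave (-s) ξ := by
  have hi : Integrable (fun p : (ι → ℂ) × (ι → ℂ) => f p.1 * h p.2 * planeWave (-p.1) p.2)
      (volume.prod volume) :=
    (hf.mul_prod hh).mul_bdd (c := 1)
      (continuous_planeWave.comp (by fun_prop : Continuous fun p : (ι → ℂ) × (ι → ℂ) =>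
        (-p.1, p.2))).aestronglyMeasurable
      (.of_forall fun p => (norm_planeWave _ _).le)
  have h1 := integral_integral_swap (f := fun s ξ => f s * h ξ * planeWave (-s) ξ) hi
  simp only [← integral_const_mul, ← integral_mul_const]
  calc _ = _ := by
        refine integral_congr_ae (.of_forall fun s => integral_congr_ae (.of_forall fun ξ => ?_))
        change _ = f s * h ξ * planeWave (-s) ξ
        ring
    _ = _ := h1
    _ = _ := by
        refine integral_congr_ae (.of_forall fun s => integral_congr_ae (.of_forall fun ξ => ?_))
        ring

end PlaneWave

theorem integrable_one_add_norm_pow_mul {E : Type} [NormedAddCommGroup E] [NormedSpace ℝ E]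
    [MeasurableSpace E] [BorelSpace E] [SecondCountableTopology E]
    (μ : Measure E) [μ.HasTemperateGrowth] (c : E) (K : ℕ) (χ : 𝓢(E, ℂ)) :
    Integrable (fun s => (1 + ‖s - c‖) ^ K * ‖χ s‖) μ := by
  have h1 : Integrable (fun s => (1 + ‖c‖) ^ K * (2 ^ (K - 1) * (‖χ s‖ + ‖s‖ ^ K * ‖χ s‖))) μ :=
    (((χ.integrable).norm.add (χ.integrable_pow_mul μ K)).const_mul _).const_mul _
  refine h1.mono' ((by fun_prop : Continuous fun s => (1 + ‖s - c‖) ^ K).mul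
    χ.continuous.norm).aestronglyMeasurable (.of_forall fun s => ?_)
  rw [Real.norm_of_nonneg (by positivity)]
  have h2 : 1 + ‖s - c‖ ≤ (1 + ‖c‖) * (1 + ‖s‖) := by
    nlinarith [norm_sub_le s c, norm_nonneg s, norm_nonneg c,
      mul_nonneg (norm_nonneg s) (norm_nonneg c)]
  have h3 : (1 + ‖s‖) ^ K ≤ 2 ^ (K - 1) * (1 + ‖s‖ ^ K) := by
    simpa using add_pow_le zero_le_one (norm_nonneg s) K
  calc (1 + ‖s - c‖) ^ K * ‖χ s‖ ≤ ((1 + ‖c‖) * (1 + ‖s‖)) ^ K * ‖χ s‖ := by gcongr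
    _ = (1 + ‖c‖) ^ K * ((1 + ‖s‖) ^ K * ‖χ s‖) := by rw [mul_pow]; ring
    _ ≤ (1 + ‖c‖) ^ K * ((2 ^ (K - 1) * (1 + ‖s‖ ^ K)) * ‖χ s‖) := by gcongr
    _ = _ := by ring

theorem integral_mul_planeWave_neg_eq {ι : Type} [Fintype ι] (R : 𝓢(ι → ℂ, ℂ)) (ξ : ι → ℂ) :
    ∫ w, fourierCLM ι R w * planeWave (-w) ξ =
      ((2 * Real.pi : ℝ) ^ (2 * Fintype.card ι) : ℂ) * R ξ := by
  rw [← fourierCLM_inversion]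
  simp only [planeWave_neg]

/-- If the Fourier transform of `a` is the function `g`, then `a` applied to the translates of the
Fourier transform of a compactly supported function `R` is an ordinary Fourier integral. -/
theorem apply_translate_fourier {l : ℕ} {a : 𝓢'(Fin l → ℂ, ℂ)} {g : (Fin l → ℂ) → ℂ}
    (ha : HasFourierFunction a g) {R : 𝓢(Fin l → ℂ, ℂ)} (hR : HasCompactSupport R)
    (v : Fin l → ℂ) :
    a (SchwartzMap.compSubConstCLM ℂ v (fourierCLM (Fin l) R)) =
      ∫ ξ, g ξ * R ξ * planeWave (-v) ξ := by
  have hs : HasCompactSupport fun ξ => R ξ * planeWave (-v) ξ := hR.mul_right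
  -- Modulating `R` by a plane wave translates its Fourier transform and preserves compact support.
  let S : 𝓢(Fin l → ℂ, ℂ) := hs.toSchwartzMap ((R.smooth ⊤).mul (contDiff_planeWave (-v)))
  have h1 : SchwartzMap.compSubConstCLM ℂ v (fourierCLM (Fin l) R) = fourierSchwartz S := by
    ext w
    rw [SchwartzMap.compSubConstCLM_apply, fourierSchwartz_eq, fourierCLM_apply, fourierCLM_apply]
    refine integral_congr_ae (.of_forall fun ξ => ?_)
    change R ξ * planeWave (w - v) ξ = R ξ * planeWave (-v) ξ * planeWave w ξ
    rw [sub_eq_add_neg, planeWave_add]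
    ring
  rw [h1, ha.2 S hs]
  refine integral_congr_ae (.of_forall fun ξ => ?_)
  change g ξ * (R ξ * planeWave (-v) ξ) = _
  ring

/-- The convolution of a tempered distribution `a` with a Schwartz function `P` defines a tempered
distribution, and if the Fourier transform of `a` is a function, so is that of the convolution. -/
theorem hasFourierFunction_convolution {l : ℕ} {a : 𝓢'(Fin l → ℂ, ℂ)} {g : (Fin l → ℂ) → ℂ}
    (ha : HasFourierFunction a g) (P : 𝓢(Fin l → ℂ, ℂ)) (c : Fin l → ℂ) {ψ : (Fin l → ℂ) → ℂ}
    (hψ : ∀ s, ψ s = a (SchwartzMap.compSubConstCLM ℂ (s - c) P)) :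
    (∀ χ : 𝓢(Fin l → ℂ, ℂ), Integrable fun s => ψ s * χ s) ∧
    HasFourierFunction (fun χ => ∫ s, ψ s * χ s)
      (fun ξ => g ξ * (planeWave c ξ * ∫ w, P w * planeWave (-w) ξ)) := by
  obtain ⟨R, rfl⟩ := fourierCLM_surjective (Fin l) P
  -- The function `g` is tested only against compact supports, and `g * R` need not be integrable.
  -- The identity is therefore proved for cut-offs `R' j`, and both sides pass to the limit by
  -- dominated convergence.
  obtain ⟨R', hsupp, hle, hlim⟩ := exists_tendsto_compactSupport R
  obtain ⟨K, q, hq, hbound⟩ := norm_temperedDistribution_translate_le a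
  have hg := ha.1
  let P' : ℕ → 𝓢(Fin l → ℂ, ℂ) := fun j => fourierCLM (Fin l) (R' j)
  have hP' : Filter.Tendsto P' Filter.atTop (nhds (fourierCLM (Fin l) R)) :=
    ((fourierCLM (Fin l)).continuous.tendsto R).comp hlim
  -- Continuity of `q` along the convergent sequence `P'` makes the polynomial bound uniform in `j`.
  obtain ⟨M, hM⟩ : ∃ M, ∀ j, q (P' j) ≤ M := by
    obtain ⟨M, hM⟩ := ((hq.tendsto _).comp hP').bddAbove_range
    exact ⟨M, fun j => hM ⟨j, rfl⟩⟩
  let ψ' : ℕ → (Fin l → ℂ) → ℂ := fun j s => a (SchwartzMap.compSubConstCLM ℂ (s - c) (P' j))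
  have hgR : ∀ j, Integrable fun ξ => g ξ * R' j ξ * planeWave c ξ := fun j => by
    have h1 := hg.integrable_smul_right_of_hasCompactSupport
      ((R' j).continuous.mul (continuous_planeWave.comp (by fun_prop : Continuous fun ξ => (c, ξ))))
      (hsupp j).mul_right
    refine h1.congr (.of_forall fun ξ => ?_)
    change g ξ * (R' j ξ * planeWave c ξ) = _
    ring
  have hψ'eq : ∀ j s, ψ' j s = ∫ ξ, g ξ * R' j ξ * planeWave c ξ * planeWave (-s) ξ := by
    intro j s
    simp only [ψ', P']
    rw [apply_translate_fourier ha (hsupp j)]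
    refine integral_congr_ae (.of_forall fun ξ => ?_)
    simp only
    rw [neg_sub, sub_eq_add_neg, planeWave_add]
    ring
  have hψ'c : ∀ j, Continuous (ψ' j) := fun j => by
    have h1 := (continuous_integral_mul_planeWave (hgR j)).comp continuous_neg
    exact h1.congr fun s => (hψ'eq j s).symm
  have hψlim : ∀ s, Filter.Tendsto (fun j => ψ' j s) Filter.atTop (nhds (ψ s)) := fun s => by
    rw [hψ]
    exact ((a.continuous.comp (SchwartzMap.compSubConstCLM ℂ (s - c)).continuous).tendsto _).comp
      hP'
  have hψm : AEStronglyMeasurable ψ :=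
    aestronglyMeasurable_of_tendsto_ae Filter.atTop (fun j => (hψ'c j).aestronglyMeasurable)
      (.of_forall hψlim)
  have hψ'b : ∀ j s, ‖ψ' j s‖ ≤ M * (1 + ‖s - c‖) ^ K := fun j s => by
    rw [mul_comm]
    exact (hbound _ _).trans (by gcongr; exact hM j)
  have hψb : ∀ s, ‖ψ s‖ ≤ M * (1 + ‖s - c‖) ^ K := fun s =>
    le_of_tendsto (hψlim s).norm (.of_forall fun j => hψ'b j s)
  have hdom : ∀ χ : 𝓢(Fin l → ℂ, ℂ), Integrable fun s => M * ((1 + ‖s - c‖) ^ K * ‖χ s‖) :=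
    fun χ => (integrable_one_add_norm_pow_mul volume c K χ).const_mul M
  refine ⟨fun χ => ?_, ?_, fun χ hχ => ?_⟩
  · refine (hdom χ).mono' (hψm.mul χ.continuous.aestronglyMeasurable) (.of_forall fun s => ?_)
    rw [norm_mul, ← mul_assoc]
    gcongr
    exact hψb s
  · have hcont : Continuous fun ξ => planeWave c ξ *
        ∫ w, fourierCLM (Fin l) R w * planeWave (-w) ξ := by
      simp only [integral_mul_planeWave_neg_eq]
      exact (continuous_planeWave.comp (by fun_prop : Continuous fun ξ => (c, ξ))).mul
        (continuous_const.mul R.continuous)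
    rw [← locallyIntegrableOn_univ] at hg ⊢
    exact hg.mul_continuousOn hcont.continuousOn isOpen_univ.isLocallyClosed
  · have hgχ : Integrable fun ξ => g ξ * χ ξ := by
      simpa using hg.integrable_smul_right_of_hasCompactSupport χ.continuous hχ
    set C : ℂ := ((2 * Real.pi : ℝ) ^ (2 * Fintype.card (Fin l)) : ℂ) with hC
    have hlhs : Filter.Tendsto (fun j => ∫ s, ψ' j s * fourierSchwartz χ s) Filter.atTop
        (nhds (∫ s, ψ s * fourierSchwartz χ s)) := by
      refine tendsto_integral_of_dominated_convergence _
        (fun j => (hψ'c j).aestronglyMeasurable.mul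
          (fourierSchwartz χ).continuous.aestronglyMeasurable) (hdom (fourierSchwartz χ))
        (fun j => .of_forall fun s => ?_) (.of_forall fun s => (hψlim s).mul_const _)
      rw [norm_mul, ← mul_assoc]
      gcongr
      exact hψ'b j s
    have hR'pt : ∀ ξ, Filter.Tendsto (fun j => R' j ξ) Filter.atTop (nhds (R ξ)) := fun ξ =>
      (((TemperedDistribution.delta ξ).continuous).tendsto R).comp hlim
    have hrhs : Filter.Tendsto
        (fun j => ∫ ξ, g ξ * R' j ξ * planeWave c ξ * (C * χ ξ)) Filter.atTop
        (nhds (∫ ξ, g ξ * R ξ * planeWave c ξ * (C * χ ξ))) := by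
      obtain ⟨B, -, hB⟩ := R.decay 0 0
      refine tendsto_integral_of_dominated_convergence (fun ξ => B * ‖C‖ * ‖g ξ * χ ξ‖)
        (fun j => (hgR j).aestronglyMeasurable.mul
          (continuous_const.mul χ.continuous).aestronglyMeasurable) (hgχ.norm.const_mul _)
        (fun j => .of_forall fun ξ => ?_)
        (.of_forall fun ξ => (((hR'pt ξ).const_mul _).mul_const _).mul_const _)
      have h1 : ‖R' j ξ‖ ≤ B := (hle j ξ).trans (by simpa using hB ξ)
      rw [norm_mul, norm_mul, norm_mul, norm_mul, norm_mul, norm_planeWave, mul_one]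
      calc ‖g ξ‖ * ‖R' j ξ‖ * (‖C‖ * ‖χ ξ‖) ≤ ‖g ξ‖ * B * (‖C‖ * ‖χ ξ‖) := by gcongr
        _ = _ := by ring
    have heq : ∀ j, ∫ s, ψ' j s * fourierSchwartz χ s =
        ∫ ξ, g ξ * R' j ξ * planeWave c ξ * (C * χ ξ) := by
      intro j
      simp only [hψ'eq]
      rw [integral_mul_integral_planeWave_swap (fourierSchwartz χ).integrable (hgR j)]
      simp only [fourierSchwartz_eq, integral_mul_planeWave_neg_eq]
      rfl
    simp only [heq] at hlhs
    refine (tendsto_nhds_unique hlhs hrhs).trans ?_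
    refine integral_congr_ae (.of_forall fun ξ => ?_)
    simp only [integral_mul_planeWave_neg_eq, ← hC]
    ring

/-! ### The Crofton number -/

/-- The components of the polynomial map `(t, ξ) ↦ (-ξ u(t), ξ)`. -/
noncomputable def croftonPoly {k l : ℕ} (u : Matrix (Fin l) (Fin k) (MvPolynomial (Fin k) ℂ)) :
    Fin k ⊕ Fin l → MvPolynomial (Fin k ⊕ Fin l) ℂ :=
  Sum.elim
    (fun j => -∑ i, MvPolynomial.X (Sum.inr i) * MvPolynomial.rename Sum.inl (u i j))
    (fun i => MvPolynomial.X (Sum.inr i))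

section Crofton

variable {k l : ℕ} (u : Matrix (Fin l) (Fin k) (MvPolynomial (Fin k) ℂ))

theorem polyMap_croftonPoly (t : Fin k → ℂ) (ξ : Fin l → ℂ) :
    polyMap (croftonPoly u) (Sum.elim t ξ) =
      Sum.elim (-(Matrix.vecMul ξ (evalMatrix u t))) ξ := by
  ext (j | i)
  · simp [polyMap, croftonPoly, Matrix.vecMul, dotProduct, evalMatrix, MvPolynomial.eval_rename]
  · simp [polyMap, croftonPoly]

/-- The Jacobian matrix is block triangular with an identity block for `ξ`; the sign coming from `-ξ
u(t)` disappears in the norm. -/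
theorem norm_det_polyJacobian_croftonPoly (t : Fin k → ℂ) (ξ : Fin l → ℂ) :
    ‖(polyJacobian (croftonPoly u) (Sum.elim t ξ)).det‖ = ‖jacobian u ξ t‖ := by
  classical
  let J : Matrix (Fin k) (Fin k) ℂ := Matrix.of fun j m : Fin k =>
    ∑ i, ξ i * MvPolynomial.eval t (MvPolynomial.pderiv m (u i j))
  have h : polyJacobian (croftonPoly u) (Sum.elim t ξ) =
      Matrix.fromBlocks (-J) (Matrix.toBlocks₁₂ (polyJacobian (croftonPoly u) (Sum.elim t ξ)))
        0 1 := by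
    ext (j | i) (m | i')
    · simp [polyJacobian, croftonPoly, J, Derivation.leibniz, MvPolynomial.pderiv_X,
        MvPolynomial.pderiv_rename Sum.inl_injective, MvPolynomial.eval_rename]
    · rfl
    · simp [polyJacobian, croftonPoly, MvPolynomial.pderiv_X]
    · simp [polyJacobian, croftonPoly, MvPolynomial.pderiv_X, Matrix.one_apply, Pi.single_apply,
        apply_ite, eq_comm]
  rw [h, Matrix.det_fromBlocks_zero₂₁, Matrix.det_one, mul_one, Matrix.det_neg, norm_mul, norm_pow,
    norm_neg, norm_one, one_pow, one_mul]
  rfl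

theorem encard_fibre_croftonPoly (η : Fin k → ℂ) (ξ : Fin l → ℂ) :
    Set.encard {w | polyMap (croftonPoly u) w = Sum.elim η ξ} = croftonFunction u η ξ := by
  have h1 : Function.Injective fun t : Fin k → ℂ => (Sum.elim t ξ : Fin k ⊕ Fin l → ℂ) :=
    fun t t' h => funext fun j => congrFun h (Sum.inl j)
  rw [croftonFunction, ← h1.encard_image]
  congr 1
  ext w
  rw [Set.mem_ofPred_eq, Set.mem_image]
  constructor
  · intro h
    have hw : w = Sum.elim (w ∘ Sum.inl) (w ∘ Sum.inr) := (Sum.elim_comp_inl_inr w).symm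
    rw [hw, polyMap_croftonPoly] at h
    have hξ : w ∘ Sum.inr = ξ := funext fun i => congrFun h (Sum.inr i)
    rw [hξ] at h hw
    exact ⟨w ∘ Sum.inl, funext fun j => (congrFun h (Sum.inl j)).symm, hw.symm⟩
  · rintro ⟨t, ht, rfl⟩
    rw [polyMap_croftonPoly, ← (show η = _ from ht)]

/-- The degree theorem is applied to `(t, ξ) ↦ (-ξ u(t), ξ)`. Carrying `ξ` along makes source and
target equidimensional and yields one number for all `ξ` at once. -/
theorem exists_crofton (hu : IsNonsingular u) :
    ∃ N : ℕ, N ≠ 0 ∧ IsCroftonNumber u N ∧ ∀ G : (Fin k → ℂ) × (Fin l → ℂ) → ℂ, Integrable G →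
      Integrable (fun p : (Fin k → ℂ) × (Fin l → ℂ) =>
        (‖jacobian u p.2 p.1‖ ^ 2 : ℝ) • G (-(Matrix.vecMul p.2 (evalMatrix u p.1)), p.2)) ∧
      ∫ p : (Fin k → ℂ) × (Fin l → ℂ),
        (‖jacobian u p.2 p.1‖ ^ 2 : ℝ) • G (-(Matrix.vecMul p.2 (evalMatrix u p.1)), p.2) =
          N * ∫ p, G p := by
  obtain ⟨ξ₀, t₀, h₀⟩ := hu
  have hdet : (polyJacobian (croftonPoly u) (Sum.elim t₀ ξ₀)).det ≠ 0 := by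
    rw [← norm_ne_zero_iff, norm_det_polyJacobian_croftonPoly]
    exact norm_ne_zero_iff.2 h₀
  obtain ⟨N, hN, hfib, hint⟩ := exists_degree_polyMap hdet
  let e := MeasurableEquiv.sumPiEquivProdPi (fun _ : Fin k ⊕ Fin l => ℂ)
  have he : MeasurePreserving e := volume_measurePreserving_sumPiEquivProdPi _
  have hes : MeasurePreserving e.symm := he.symm e
  have hsymm : ∀ p : (Fin k → ℂ) × (Fin l → ℂ), e.symm p = Sum.elim p.1 p.2 := fun p => by
    ext (i | i) <;> rfl
  refine ⟨N, hN, ?_, fun G hG => ?_⟩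
  · filter_upwards [hes.quasiMeasurePreserving.ae hfib] with p hp
    rw [← encard_fibre_croftonPoly, ← hsymm]
    exact hp
  · obtain ⟨h1, h2⟩ := hint (G ∘ e) (he.integrable_comp_of_integrable hG)
    have h3 : ∀ p : (Fin k → ℂ) × (Fin l → ℂ),
        (‖(polyJacobian (croftonPoly u) (e.symm p)).det‖ ^ 2 : ℝ) •
          (G ∘ e) (polyMap (croftonPoly u) (e.symm p)) =
        (‖jacobian u p.2 p.1‖ ^ 2 : ℝ) • G (-(Matrix.vecMul p.2 (evalMatrix u p.1)), p.2) := by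
      intro p
      rw [hsymm, norm_det_polyJacobian_croftonPoly, polyMap_croftonPoly]
      rfl
    have h4 := hes.integrable_comp_of_integrable h1
    have h5 := hes.integral_comp e.symm.measurableEmbedding
      (fun w => (‖(polyJacobian (croftonPoly u) w).det‖ ^ 2 : ℝ) •
          (G ∘ e) (polyMap (croftonPoly u) w))
    simp only [h3] at h5
    refine ⟨h4.congr (.of_forall h3), ?_⟩
    rw [h5, h2]
    congr 1
    exact he.integral_comp e.measurableEmbedding G

end Crofton

/-! ### Fourier inversion on `ℂ^k ⊕ ℂ^l` -/

theorem planeWave_sumElim {k l : ℕ} (x η : Fin k → ℂ) (y ξ : Fin l → ℂ) :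
    planeWave (Sum.elim x y) (Sum.elim η ξ) = planeWave x η * planeWave y ξ := by
  simp only [planeWave, ← Complex.exp_add, dotProduct, Fintype.sum_sum_type, Sum.elim_inl,
    Sum.elim_inr, Complex.add_re, Complex.ofReal_add, mul_add]

theorem exists_fourier_inversion_prod {k l : ℕ} (f : 𝓢((Fin k → ℂ) × (Fin l → ℂ), ℂ)) :
    ∃ F : (Fin k → ℂ) × (Fin l → ℂ) → ℂ,
      (∀ η ξ, ∫ q : (Fin k → ℂ) × (Fin l → ℂ),
        f q * (planeWave (-q.1) η * planeWave (-q.2) ξ) = F (η, ξ)) ∧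
      ∀ x y, Integrable (fun p => F p * (planeWave x p.1 * planeWave y p.2)) ∧
        ∫ p, F p * (planeWave x p.1 * planeWave y p.2) =
        ((2 * Real.pi : ℝ) ^ (2 * (k + l)) : ℂ) * f (x, y) := by
  let e := MeasurableEquiv.sumPiEquivProdPi (fun _ : Fin k ⊕ Fin l => ℂ)
  have he : MeasurePreserving e := volume_measurePreserving_sumPiEquivProdPi _
  have hes : MeasurePreserving e.symm := he.symm e
  have hsymm : ∀ p : (Fin k → ℂ) × (Fin l → ℂ), e.symm p = Sum.elim p.1 p.2 := fun p => by
    ext (i | i) <;> rfl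
  let L : (Fin k ⊕ Fin l → ℂ) ≃L[ℝ] ((Fin k → ℂ) × (Fin l → ℂ)) :=
    ContinuousLinearEquiv.sumPiEquivProdPi ℝ (Fin k) (Fin l) (fun _ => ℂ)
  let f' : 𝓢(Fin k ⊕ Fin l → ℂ, ℂ) := SchwartzMap.compCLMOfContinuousLinearEquiv ℂ L f
  have hf' : ∀ p : (Fin k → ℂ) × (Fin l → ℂ), f' (e.symm p) = f p := fun p => rfl
  obtain ⟨R, hR⟩ := fourierCLM_surjective _ f'
  set C : ℂ := ((2 * Real.pi : ℝ) ^ (2 * (k + l)) : ℂ) with hC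
  have hcard : Fintype.card (Fin k ⊕ Fin l) = k + l := by simp
  have hint : Integrable fun p : (Fin k → ℂ) × (Fin l → ℂ) => C * R (e.symm p) :=
    (hes.integrable_comp_of_integrable R.integrable).const_mul C
  refine ⟨fun p => C * R (e.symm p), fun η ξ => ?_, fun x y => ⟨?_, ?_⟩⟩
  · have h1 := integral_mul_planeWave_neg_eq R (e.symm (η, ξ))
    rw [hR, hcard, ← hes.integral_comp e.symm.measurableEmbedding] at h1
    refine Eq.trans ?_ h1
    refine integral_congr_ae (.of_forall fun q => ?_)
    simp only [hf']
    have : -(e.symm q) = Sum.elim (-q.1) (-q.2) := by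
      rw [hsymm]; ext (i | i) <;> rfl
    rw [this, hsymm, planeWave_sumElim]
  · refine hint.mul_bdd (c := 1) ?_ (.of_forall fun p => ?_)
    · exact ((continuous_planeWave.comp (by fun_prop :
        Continuous fun p : (Fin k → ℂ) × (Fin l → ℂ) => (x, p.1))).mul
        (continuous_planeWave.comp (by fun_prop :
        Continuous fun p : (Fin k → ℂ) × (Fin l → ℂ) => (y, p.2)))).aestronglyMeasurable
    · rw [norm_mul, norm_planeWave, norm_planeWave, one_mul]
  · have h1 := fourierCLM_apply R (e.symm (x, y))
    rw [hR, hf', ← hes.integral_comp e.symm.measurableEmbedding] at h1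
    rw [h1, ← integral_const_mul]
    refine integral_congr_ae (.of_forall fun p => ?_)
    change _ = C * (R (e.symm p) * planeWave (e.symm (x, y)) (e.symm p))
    simp only [hsymm, planeWave_sumElim]
    ring

/-- The Fourier transform of the plane integrals of `f` is the restriction of the Fourier transform
of `f` to a plane. -/
theorem integral_planeIntegral_mul_planeWave {k l : ℕ} (f : 𝓢((Fin k → ℂ) × (Fin l → ℂ), ℂ))
    (M : Matrix (Fin l) (Fin k) ℂ) (ξ : Fin l → ℂ) :
    ∫ w, planeIntegral f M 0 w * planeWave (-w) ξ =
      ∫ q : (Fin k → ℂ) × (Fin l → ℂ),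
        f q * (planeWave (-q.1) (-(Matrix.vecMul ξ M)) * planeWave (-q.2) ξ) := by
  let h : (Fin k → ℂ) × (Fin l → ℂ) → ℂ := fun q =>
    f q * (planeWave (-q.1) (-(Matrix.vecMul ξ M)) * planeWave (-q.2) ξ)
  have hh : Integrable h := by
    have : (volume : Measure ((Fin k → ℂ) × (Fin l → ℂ))).IsAddHaarMeasure :=
      Measure.prod.instIsAddHaarMeasure (volume : Measure (Fin k → ℂ))
        (volume : Measure (Fin l → ℂ))
    refine f.integrable.mul_bdd (c := 1) ?_ (.of_forall fun p => ?_)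
    · exact ((continuous_planeWave.comp (by fun_prop :
        Continuous fun p : (Fin k → ℂ) × (Fin l → ℂ) => (-p.1, -(Matrix.vecMul ξ M)))).mul
        (continuous_planeWave.comp (by fun_prop :
        Continuous fun p : (Fin k → ℂ) × (Fin l → ℂ) => (-p.2, ξ)))).aestronglyMeasurable
    · rw [norm_mul, norm_planeWave, norm_planeWave, one_mul]
  have hM : Continuous fun x : Fin k → ℂ => M.mulVec x :=
    continuous_const.matrix_mulVec continuous_id
  -- The shear carries the parallel planes `y = M x + w` to `w = const`; the phase `exp(-i Re⟨w,
  -- ξ⟩)` then depends on `w` only.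
  have hsh : MeasurePreserving
      (fun p : (Fin k → ℂ) × (Fin l → ℂ) => (p.1, M.mulVec p.1 + p.2)) :=
    (MeasurePreserving.id volume).skew_product
      (g := fun x w => M.mulVec x + w)
      (by exact ((hM.comp continuous_fst).add continuous_snd).measurable)
      (.of_forall fun x => (measurePreserving_add_left volume (M.mulVec x)).map_eq)
  have hhs : Integrable (fun p : (Fin k → ℂ) × (Fin l → ℂ) => h (p.1, M.mulVec p.1 + p.2)) :=
    hsh.integrable_comp_of_integrable hh
  have hval : ∀ x w, h (x, M.mulVec x + w) = f (x, M.mulVec x + w) * planeWave (-w) ξ := by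
    intro x w
    have h1 : planeWave (-x) (-(Matrix.vecMul ξ M)) = planeWave (M.mulVec x) ξ := by
      simp only [planeWave, neg_dotProduct, dotProduct_neg, neg_neg]
      rw [dotProduct_comm x, ← Matrix.dotProduct_mulVec, dotProduct_comm ξ]
    simp only [h]
    rw [h1, neg_add, planeWave_add, ← mul_assoc (planeWave _ ξ), planeWave_mul_neg, one_mul]
  change _ = ∫ q, h q
  calc ∫ w, planeIntegral f M 0 w * planeWave (-w) ξ
      = ∫ w, ∫ x, h (x, M.mulVec x + w) := by
        refine integral_congr_ae (.of_forall fun w => ?_)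
        simp only [hval]
        rw [integral_mul_const]
        congr 1
        change ∫ x, f (x, M.mulVec x + 0 + w) = _
        simp only [add_zero]
    _ = ∫ x, ∫ w, h (x, M.mulVec x + w) :=
        (integral_integral_swap (f := fun x w => h (x, M.mulVec x + w)) hhs).symm
    _ = ∫ x, ∫ y, h (x, y) := by
        refine integral_congr_ae (.of_forall fun x => ?_)
        exact integral_add_left_eq_self (fun y => h (x, y)) (M.mulVec x)
    _ = ∫ q, h q := (integral_prod h hh).symm

theorem planeIntegral_eq_translate {k l : ℕ} (f : 𝓢((Fin k → ℂ) × (Fin l → ℂ), ℂ))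
    (M : Matrix (Fin l) (Fin k) ℂ) (α : Fin l → ℂ) :
    planeIntegral f M α = SchwartzMap.compSubConstCLM ℂ (-α) (planeIntegral f M 0) := by
  ext s
  change ∫ x, f (x, M.mulVec x + α + s) = ∫ x, f (x, M.mulVec x + 0 + (s - -α))
  simp only [add_zero, sub_neg_eq_add, add_assoc, add_comm α]

end PlaneComplex

/-- In the conclusion `I t` is the inner integral `∫ φ(α, t) A(y - u(t) x - α, t) dα`, that is, the
value of the generalized function `A(·, t)` on `s ↦ φ(y - u(t) x - s, t)`, where `φ = J_a f`. -/
theorem mainTheorem1 {k l : ℕ} (hk : 0 < k) (hl : 1 < l)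
    (u : Matrix (Fin l) (Fin k) (MvPolynomial (Fin k) ℂ)) (hu : PlaneComplex.IsNonsingular u) :
    ∃ N : ℕ, N ≠ 0 ∧ PlaneComplex.IsCroftonNumber u N ∧
      ∀ (a : (Fin k → ℂ) → 𝓢'(Fin l → ℂ, ℂ)) (ã : (Fin l → ℂ) → (Fin k → ℂ) → ℂ),
        (∀ᵐ t : Fin k → ℂ, PlaneComplex.HasFourierFunction (a t) fun ξ => ã ξ t) →
        (∀ᵐ p : (Fin l → ℂ) × (Fin k → ℂ), ã p.1 p.2 ≠ 0) →
        ∀ (f : 𝓢((Fin k → ℂ) × (Fin l → ℂ), ℂ)) (x : Fin k → ℂ) (y : Fin l → ℂ),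
          ∃ I : (Fin k → ℂ) → ℂ,
            (∀ᵐ t : Fin k → ℂ, PlaneComplex.HasFourierPairing
              (PlaneComplex.kernelDensity u N ã t)
              (fun s => PlaneComplex.transform u a f
                (y - Matrix.mulVec (PlaneComplex.evalMatrix u t) x - s) t)
              (I t)) ∧
            Integrable I ∧ f (x, y) = ∫ t, I t := by
  obtain ⟨N, hN, hCr, harea⟩ := PlaneComplex.exists_crofton u hu
  refine ⟨N, hN, hCr, fun a ã ha hã f x y => ?_⟩
  obtain ⟨F, hF, hinv⟩ := PlaneComplex.exists_fourier_inversion_prod f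
  let G : (Fin k → ℂ) × (Fin l → ℂ) → ℂ := fun p =>
    F p * (PlaneComplex.planeWave x p.1 * PlaneComplex.planeWave y p.2)
  obtain ⟨hint, heq⟩ := harea G (hinv x y).1
  set C : ℂ := ((2 * Real.pi : ℝ) ^ (2 * (k + l)) : ℂ) with hC
  have hC0 : C ≠ 0 := by simp [hC, Real.pi_ne_zero]
  -- This is the integrand left after `ã` cancels. Its integrability on the product gives, by
  -- Fubini, the inner integrals for almost every `t` and their integrability in `t`.
  let H : (Fin k → ℂ) × (Fin l → ℂ) → ℂ := fun p => C⁻¹ * (N : ℂ)⁻¹ *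
    ((‖PlaneComplex.jacobian u p.2 p.1‖ ^ 2 : ℝ) •
      G (-(Matrix.vecMul p.2 (PlaneComplex.evalMatrix u p.1)), p.2))
  have hH : Integrable H := hint.const_mul _
  refine ⟨fun t => ∫ ξ, H (t, ξ), ?_, hH.integral_prod_left, ?_⟩
  · have hã' : ∀ᵐ t : Fin k → ℂ, ∀ᵐ ξ : Fin l → ℂ, ã ξ t ≠ 0 :=
      Measure.ae_ae_of_ae_prod
        (Measure.measurePreserving_swap.quasiMeasurePreserving.ae hã)
    filter_upwards [ha, hã', hH.prod_right_ae] with t hat hãt hHt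
    set M := PlaneComplex.evalMatrix u t with hM
    set c := y - M.mulVec x with hc
    obtain ⟨h1, h2⟩ := PlaneComplex.hasFourierFunction_convolution hat
      (PlaneComplex.planeIntegral f M 0) c
      (ψ := fun s => PlaneComplex.transform u a f (c - s) t) (fun s => by
        rw [PlaneComplex.transform, PlaneComplex.planeIntegral_eq_translate, neg_sub])
    have h3 : ∀ᵐ ξ : Fin l → ℂ, H (t, ξ) = PlaneComplex.kernelDensity u N ã t ξ *
        (ã ξ t * (PlaneComplex.planeWave c ξ *
          ∫ w, PlaneComplex.planeIntegral f M 0 w * PlaneComplex.planeWave (-w) ξ)) := by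
      filter_upwards [hãt] with ξ hξ
      -- Since `⟨M x, ξ⟩ = ⟨x, ξ M⟩`, the phase at `c = y - M x` is that of `(x, y)` at the
      -- frequency `(-ξ M, ξ)`.
      have hw : PlaneComplex.planeWave c ξ =
          PlaneComplex.planeWave x (-(Matrix.vecMul ξ M)) * PlaneComplex.planeWave y ξ := by
        rw [hc, sub_eq_add_neg, PlaneComplex.planeWave_add, mul_comm]
        congr 1
        simp only [PlaneComplex.planeWave, neg_dotProduct, dotProduct_neg]
        rw [dotProduct_comm x, ← Matrix.dotProduct_mulVec, dotProduct_comm ξ]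
      rw [PlaneComplex.integral_planeIntegral_mul_planeWave, hF, hw,
        PlaneComplex.kernelDensity, ← hC]
      simp only [H, G, Complex.real_smul, ← hM]
      field_simp
    refine ⟨h1, _, h2, hHt.congr h3, integral_congr_ae h3⟩
  · have hN' : (N : ℂ) ≠ 0 := Nat.cast_ne_zero.2 hN
    have h1 : ∫ t, ∫ ξ, H (t, ξ) = ∫ p, H p := (integral_prod H hH).symm
    rw [h1]
    simp only [H]
    rw [integral_const_mul, heq, (hinv x y).2]
    field_simp
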